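/- Let $M$ be a smooth Hausdorff surface and let $E\to M$ be a smooth real vector bundle of rank $4$ equipped with a smooth nondegenerate symmetric metric $\langle\,,\rangle$, a smooth bundle endomorphism $J$ with $J^2=-1$ and $\langle Jv,Jw\rangle=\langle v,w\rangle$, the metric being of complex index one (real signature $(2,2)$), a smooth connection $\tilde\nabla$ with $\tilde\nabla\langle\,,\rangle=0$ and $\tilde\nabla J=0$, and a smooth bundle map $\iota:TM\to E$ with $\tilde\nabla_X\iota Y-\tilde\nabla_Y\iota X=\iota[X,Y]$ for which the induced metric $g=\langle\iota\cdot,\iota\cdot\rangle$ on $M$ is Lorentzian. (For a Lorentzian surface $f:M\to\tilde M^2_1$ immersed in a Lorentzian Kähler surface, take $E=f^*T\tilde M^2_1$ with the pulled back metric, complex structure and Levi-Civita connection, and $\iota=df$.) Omit $\iota$ from the notation, and let ${}^\top,{}^\perp$ be the tangential and normal components. Define $\nabla,h,A,D$ by the formulas of Gauss and Weingarten, $$\tilde\nabla_XY=\nabla_XY+h(X,Y),\qquad \tilde\nabla_X\xi=-A_\xi X+D_X\xi$$ for $X,Y$ tangent and $\xi$ normal; let $R,R^D$ be the curvature tensors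 of $\nabla,D$, and put $(\bar\nabla_Xh)(Y,Z)=D_Xh(Y,Z)-h(\nabla_XY,Z)-h(Y,\nabla_XZ)$. For $c\in\mathbb R$ let $$\tilde R(X,Y)Z=c\{\langle Y,Z\rangle X-\langle X,Z\rangle Y+\langle JY,Z\rangle JX-\langle JX,Z\rangle JY+2\langle X,JY\rangle JZ\}$$ be the curvature tensor of a Lorentzian complex space form $\tilde M^2_1(4c)$. The equations of Gauss, Codazzi and Ricci of a surface in $\tilde M^2_1(4c)$ are $$\langle R(X,Y)Z,W\rangle=\langle\tilde R(X,Y)Z,W\rangle+\langle h(X,W),h(Y,Z)\rangle-\langle h(X,Z),h(Y,W)\rangle,$$ $$(\tilde R(X,Y)Z)^\perp=(\bar\nabla_Xh)(Y,Z)-(\bar\nabla_Yh)(X,Z),$$ $$\langle R^D(X,Y)\xi,\eta\rangle=\langle\tilde R(X,Y)\xi,\eta\rangle+\langle[A_\xi,A_\eta]X,Y\rangle$$ for $X,Y,Z,W$ tangent and $\xi,\eta$ normal to $M$. They are regarded as conditions on the above data: the curvature of $\tilde\nabla$ is not assumed to be $\tilde R$. Assume that $M$ is minimal ($H=\frac12\operatorname{trace}h=0$)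 and flat ($R=0$). Then: (1) The equation of Ricci is a consequence of the equations of Gauss and Codazzi: at every point of $M$ at which the equations of Gauss and Codazzi hold, the equation of Ricci holds. (2) Let $e_1,e_2$ be smooth vector fields on an open set $U\subset M$ with $\langle e_1,e_1\rangle=\langle e_2,e_2\rangle=0$, $\langle e_1,e_2\rangle=-1$ and $\nabla e_1=\nabla e_2=0$ (for example $e_1=\partial/\partial x$, $e_2=\partial/\partial y$ for local coordinates with $g=-dx\otimes dy-dy\otimes dx$), write $f_x=e_1f$, $f_y=e_2f$ and $f_{xy}=e_2(e_1f)$ for a function $f$, and define the Wirtinger angle $\alpha$ on $U$ by $\sinh\alpha=-\langle Je_1,e_2\rangle$. Then $\alpha$ is smooth on $U$, $(Je_1)^\top=(\sinh\alpha)e_1$, $(Je_2)^\top=-(\sinh\alpha)e_2$, and with $e_3=(\operatorname{sech}\alpha)(Je_1)^\perp$, $e_4=(\operatorname{sech}\alpha)(Je_2)^\perp$ there are functions $\beta,\gamma,\lambda,\mu$ on $U$ such that $$h(e_1,e_1)=\beta e_3+\gamma e_4,\qquad h(e_1,e_2)=0,\qquad h(e_2,e_2)=\lambda e_3+\mu e_4.$$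 At every point of $U$ the equation of Codazzi implies $$\alpha_{xy}=\alpha_x\alpha_y\tanh\alpha+3c\sinh\alpha\cosh\alpha,$$ and the equation of Gauss is equivalent to $$\gamma\lambda=\alpha_x\alpha_y+c(3\sinh^2\alpha-1).$$ -/

import Mathlib

open Bundle Manifold
open scoped ContDiff Topology

noncomputable section

/-- The model fibre of a real vector bundle of rank four. -/
abbrev R4 : Type := EuclideanSpace ℝ (Fin 4)

/-- The vector field `X` on the surface `M` is smooth on `U`. -/
def SmoothFieldOn {M : Type*} [TopologicalSpace M] [ChartedSpace (EuclideanSpace ℝ (Fin 2)) M]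
    [IsManifold (𝓡 2) ∞ M] (X : ∀ x : M, TangentSpace (𝓡 2) x) (U : Set M) : Prop :=
  ContMDiffOn (𝓡 2) ((𝓡 2).prod 𝓘(ℝ, EuclideanSpace ℝ (Fin 2))) ∞
    (fun x ↦ TotalSpace.mk' (EuclideanSpace ℝ (Fin 2)) x (X x)) U

/-- The vector field `X` on the surface `M` is smooth. -/
def SmoothField {M : Type*} [TopologicalSpace M] [ChartedSpace (EuclideanSpace ℝ (Fin 2)) M]
    [IsManifold (𝓡 2) ∞ M] (X : ∀ x : M, TangentSpace (𝓡 2) x) : Prop :=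
  ContMDiff (𝓡 2) ((𝓡 2).prod 𝓘(ℝ, EuclideanSpace ℝ (Fin 2))) ∞
    (fun x ↦ TotalSpace.mk' (EuclideanSpace ℝ (Fin 2)) x (X x))

/-- The vector field `X` on the surface `M` is differentiable at `x`. -/
def DiffFieldAt {M : Type*} [TopologicalSpace M] [ChartedSpace (EuclideanSpace ℝ (Fin 2)) M]
    [IsManifold (𝓡 2) ∞ M] (X : ∀ x : M, TangentSpace (𝓡 2) x) (x : M) : Prop :=
  MDifferentiableAt (𝓡 2) ((𝓡 2).prod 𝓘(ℝ, EuclideanSpace ℝ (Fin 2)))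
    (fun y ↦ TotalSpace.mk' (EuclideanSpace ℝ (Fin 2)) y (X y)) x

/-- The section `σ` of the rank four bundle `E` over `M` is smooth. -/
def SmoothSec {M : Type*} [TopologicalSpace M] [ChartedSpace (EuclideanSpace ℝ (Fin 2)) M]
    {E : M → Type*} [TopologicalSpace (TotalSpace R4 E)] [∀ x, TopologicalSpace (E x)]
    [FiberBundle R4 E] (σ : ∀ x, E x) : Prop :=
  ContMDiff (𝓡 2) ((𝓡 2).prod 𝓘(ℝ, R4)) ∞ (fun x ↦ TotalSpace.mk' R4 x (σ x))

/-- The section `σ` of the rank four bundle `E` over `M` is differentiable at `x`. -/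
def DiffSecAt {M : Type*} [TopologicalSpace M] [ChartedSpace (EuclideanSpace ℝ (Fin 2)) M]
    {E : M → Type*} [TopologicalSpace (TotalSpace R4 E)] [∀ x, TopologicalSpace (E x)]
    [FiberBundle R4 E] (σ : ∀ x, E x) (x : M) : Prop :=
  MDifferentiableAt (𝓡 2) ((𝓡 2).prod 𝓘(ℝ, R4)) (fun y ↦ TotalSpace.mk' R4 y (σ y)) x

/-- A Lorentzian surface in a Lorentzian Kähler surface, described along the surface `M`.

`E` is the tangent bundle of the ambient Kähler surface along `M`: for an immersion `f : M → M̃`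
it is the pullback bundle `f^* TM̃`, with the pulled back metric `⟨ , ⟩`, complex structure `J` and
Levi-Civita connection `∇̃`, and `ι` is the differential of `f`.
Nothing is assumed on the curvature of `∇̃`, so that the equations of Gauss, Codazzi and Ricci
are independent conditions on these data. -/
structure LorentzianSurface
    (M : Type*) [TopologicalSpace M] [ChartedSpace (EuclideanSpace ℝ (Fin 2)) M]
    [IsManifold (𝓡 2) ∞ M]
    (E : M → Type*) [TopologicalSpace (TotalSpace R4 E)] [∀ x, AddCommGroup (E x)]
    [∀ x, Module ℝ (E x)] [∀ x, TopologicalSpace (E x)] [∀ x, IsTopologicalAddGroup (E x)]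
    [∀ x, ContinuousSMul ℝ (E x)] [FiberBundle R4 E] [VectorBundle ℝ R4 E]
    [ContMDiffVectorBundle ∞ R4 E (𝓡 2)] where
  /-- The ambient metric. -/
  metric : ∀ x, E x →L[ℝ] E x →L[ℝ] ℝ
  metric_contMDiff : ContMDiff (𝓡 2) ((𝓡 2).prod 𝓘(ℝ, R4 →L[ℝ] R4 →L[ℝ] ℝ)) ∞
    (fun x ↦ TotalSpace.mk' (R4 →L[ℝ] R4 →L[ℝ] ℝ) x (metric x))
  metric_symm : ∀ x v w, metric x v w = metric x w v
  /-- The complex structure. -/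
  J : ∀ x, E x →L[ℝ] E x
  J_contMDiff : ContMDiff (𝓡 2) ((𝓡 2).prod 𝓘(ℝ, R4 →L[ℝ] R4)) ∞
    (fun x ↦ TotalSpace.mk' (R4 →L[ℝ] R4) x (J x))
  J_sq : ∀ x v, J x (J x v) = -v
  J_isometry : ∀ x v w, metric x (J x v) (J x w) = metric x v w
  /-- The ambient metric is nondegenerate of complex index one: `u, Ju, v, Jv` is an
  orthogonal basis on which it takes the values `-1, -1, 1, 1`. -/
  complex_index_one : ∀ x, ∃ u v : E x, metric x u u = -1 ∧ metric x v v = 1 ∧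
    metric x u v = 0 ∧ metric x u (J x v) = 0
  /-- The ambient Levi-Civita connection along the surface;
  `conn σ x u` is `∇̃_u σ` at the point `x`. -/
  conn : CovariantDerivative (𝓡 2) R4 E
  conn_contMDiff : CovariantDerivative.ContMDiffCovariantDerivative conn ∞
  conn_metric : ∀ (x : M) (σ τ : ∀ y, E y), DiffSecAt σ x → DiffSecAt τ x →
    ∀ u : TangentSpace (𝓡 2) x,
      mvfderiv (𝓡 2) (fun y ↦ metric y (σ y) (τ y)) x u =
        metric x (conn σ x u) (τ x) + metric x (σ x) (conn τ x u)
  /-- The Kähler condition `∇̃ J = 0`. -/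
  conn_J : ∀ (x : M) (σ : ∀ y, E y), DiffSecAt σ x → ∀ u : TangentSpace (𝓡 2) x,
    conn (fun y ↦ J y (σ y)) x u = J x (conn σ x u)
  /-- The differential of the immersion. -/
  ι : ∀ x, TangentSpace (𝓡 2) x →L[ℝ] E x
  ι_contMDiff : ContMDiff (𝓡 2) ((𝓡 2).prod 𝓘(ℝ, EuclideanSpace ℝ (Fin 2) →L[ℝ] R4)) ∞
    (fun x ↦ TotalSpace.mk' (EuclideanSpace ℝ (Fin 2) →L[ℝ] R4)
      (E := fun x ↦ TangentSpace (𝓡 2) x →L[ℝ] E x) x (ι x))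
  /-- The ambient connection has no torsion: `∇̃_X Y - ∇̃_Y X = [X, Y]`. -/
  torsion_free : ∀ (x : M) (X Y : ∀ y : M, TangentSpace (𝓡 2) y),
    DiffFieldAt X x → DiffFieldAt Y x →
    conn (fun y ↦ ι y (Y y)) x (X x) - conn (fun y ↦ ι y (X y)) x (Y x) =
      ι x (VectorField.mlieBracket (𝓡 2) X Y x)
  /-- The induced metric is Lorentzian. In particular `ι x` is injective. -/
  lorentzian : ∀ x, ∃ u v : TangentSpace (𝓡 2) x, metric x (ι x u) (ι x u) = -1 ∧
    metric x (ι x v) (ι x v) = 1 ∧ metric x (ι x u) (ι x v) = 0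

namespace LorentzianSurface

variable {M : Type*} [TopologicalSpace M] [ChartedSpace (EuclideanSpace ℝ (Fin 2)) M]
  [IsManifold (𝓡 2) ∞ M]
  {E : M → Type*} [TopologicalSpace (TotalSpace R4 E)] [∀ x, AddCommGroup (E x)]
  [∀ x, Module ℝ (E x)] [∀ x, TopologicalSpace (E x)] [∀ x, IsTopologicalAddGroup (E x)]
  [∀ x, ContinuousSMul ℝ (E x)] [FiberBundle R4 E] [VectorBundle ℝ R4 E]
  [ContMDiffVectorBundle ∞ R4 E (𝓡 2)]
  (S : LorentzianSurface M E)

instance (x : M) : FiniteDimensional ℝ (TangentSpace (𝓡 2) x) :=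
  inferInstanceAs (FiniteDimensional ℝ (EuclideanSpace ℝ (Fin 2)))

/-- The induced metric `g` of the surface. -/
def g (x : M) : LinearMap.BilinForm ℝ (TangentSpace (𝓡 2) x) :=
  LinearMap.mk₂ ℝ (fun u v ↦ S.metric x (S.ι x u) (S.ι x v))
    (by intros; simp) (by intros; simp) (by intros; simp) (by intros; simp)

theorem g_apply (x : M) (u v : TangentSpace (𝓡 2) x) :
    S.g x u v = S.metric x (S.ι x u) (S.ι x v) := rfl

theorem g_nondegenerate (x : M) : (S.g x).Nondegenerate := by
  obtain ⟨u, v, hu, hv, huv⟩ := S.lorentzian x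
  have huv' : S.metric x (S.ι x v) (S.ι x u) = 0 := by rw [S.metric_symm]; exact huv
  have hli : LinearIndependent ℝ ![u, v] := by
    rw [LinearIndependent.pair_iff]
    intro a b hab
    have h1 : S.g x (a • u + b • v) u = 0 := by rw [hab]; simp
    have h2 : S.g x (a • u + b • v) v = 0 := by rw [hab]; simp
    simp [g_apply, hu, huv'] at h1
    simp [g_apply, hv, huv] at h2
    exact ⟨h1, h2⟩
  have hspan : ∀ w : TangentSpace (𝓡 2) x, ∃ a b : ℝ, a • u + b • v = w := by
    intro w
    have hcard : Fintype.card (Fin 2) = Module.finrank ℝ (TangentSpace (𝓡 2) x) := by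
      change _ = Module.finrank ℝ (EuclideanSpace ℝ (Fin 2))
      simp
    have htop := hli.span_eq_top_of_card_eq_finrank' hcard
    have hw : w ∈ Submodule.span ℝ (Set.range ![u, v]) := by rw [htop]; trivial
    rw [Matrix.range_cons, Matrix.range_cons, Matrix.range_empty, Set.union_empty,
      Set.singleton_union, Submodule.mem_span_pair] at hw
    exact hw
  have key : ∀ w : TangentSpace (𝓡 2) x, S.g x w u = 0 → S.g x w v = 0 → w = 0 := by
    intro w h1 h2
    obtain ⟨a, b, rfl⟩ := hspan w
    simp [g_apply, hu, huv'] at h1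
    simp [g_apply, hv, huv] at h2
    simp [h1, h2]
  refine ⟨fun w hw ↦ key w (hw u) (hw v), fun w hw ↦ key w ?_ ?_⟩
  · rw [g_apply, S.metric_symm]; exact hw u
  · rw [g_apply, S.metric_symm]; exact hw v

/-- The tangential component `w^⊤` of an ambient vector, as a tangent vector of `M`. -/
def tang (x : M) (w : E x) : TangentSpace (𝓡 2) x :=
  ((S.g x).toDual (S.g_nondegenerate x)).symm
    ((S.metric x w : E x →ₗ[ℝ] ℝ) ∘ₗ (S.ι x : TangentSpace (𝓡 2) x →ₗ[ℝ] E x))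

theorem g_tang (x : M) (w : E x) (u : TangentSpace (𝓡 2) x) :
    S.g x (S.tang x w) u = S.metric x w (S.ι x u) :=
  LinearMap.BilinForm.apply_toDual_symm_apply (B := S.g x) (hB := S.g_nondegenerate x)
    ((S.metric x w : E x →ₗ[ℝ] ℝ) ∘ₗ (S.ι x : TangentSpace (𝓡 2) x →ₗ[ℝ] E x)) u

/-- The normal component `w^⊥` of an ambient vector. -/
def nor (x : M) (w : E x) : E x := w - S.ι x (S.tang x w)

theorem metric_nor_ι (x : M) (w : E x) (u : TangentSpace (𝓡 2) x) :
    S.metric x (S.nor x w) (S.ι x u) = 0 := by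
  have := S.g_tang x w u
  rw [g_apply] at this
  simp [nor, this]

/-- `ξ` is a normal vector field. -/
def IsNormal (ξ : ∀ x, E x) : Prop := ∀ x u, S.metric x (ξ x) (S.ι x u) = 0

/-- The Levi-Civita connection `∇_u Y` of `M`: the tangential part in the formula of Gauss. -/
def nabla (Y : ∀ x : M, TangentSpace (𝓡 2) x) (x : M) (u : TangentSpace (𝓡 2) x) :
    TangentSpace (𝓡 2) x :=
  S.tang x (S.conn (fun y ↦ S.ι y (Y y)) x u)

/-- The second fundamental form `h(X, Y)`: the normal part in the formula of Gauss. -/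
def h (X Y : ∀ x : M, TangentSpace (𝓡 2) x) (x : M) : E x :=
  S.nor x (S.conn (fun y ↦ S.ι y (Y y)) x (X x))

/-- The shape operator `A_ξ X`: minus the tangential part in the formula of Weingarten. -/
def shape (ξ : ∀ x, E x) (X : ∀ x : M, TangentSpace (𝓡 2) x) (x : M) : TangentSpace (𝓡 2) x :=
  -S.tang x (S.conn ξ x (X x))

/-- The normal connection `D_u ξ`: the normal part in the formula of Weingarten. -/
def normalConn (ξ : ∀ x, E x) (x : M) (u : TangentSpace (𝓡 2) x) : E x :=
  S.nor x (S.conn ξ x u)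

/-- The curvature tensor `R(X, Y)Z = ∇_X ∇_Y Z - ∇_Y ∇_X Z - ∇_[X,Y] Z` of `M`. -/
def R (X Y Z : ∀ x : M, TangentSpace (𝓡 2) x) (x : M) : TangentSpace (𝓡 2) x :=
  S.nabla (fun y ↦ S.nabla Z y (Y y)) x (X x) - S.nabla (fun y ↦ S.nabla Z y (X y)) x (Y x)
    - S.nabla Z x (VectorField.mlieBracket (𝓡 2) X Y x)

/-- The normal curvature tensor `R^D(X, Y)ξ`. -/
def RD (X Y : ∀ x : M, TangentSpace (𝓡 2) x) (ξ : ∀ x, E x) (x : M) : E x :=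
  S.normalConn (fun y ↦ S.normalConn ξ y (Y y)) x (X x)
    - S.normalConn (fun y ↦ S.normalConn ξ y (X y)) x (Y x)
    - S.normalConn ξ x (VectorField.mlieBracket (𝓡 2) X Y x)

/-- `(∇̄_X h)(Y, Z) = D_X h(Y, Z) - h(∇_X Y, Z) - h(Y, ∇_X Z)`. -/
def nablaBarH (X Y Z : ∀ x : M, TangentSpace (𝓡 2) x) (x : M) : E x :=
  S.normalConn (S.h Y Z) x (X x) - S.h (fun y ↦ S.nabla Y y (X y)) Z x
    - S.h Y (fun y ↦ S.nabla Z y (X y)) x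

/-- The curvature tensor of a complex space form of constant holomorphic sectional
curvature `4c`. -/
def Rtilde (c : ℝ) (x : M) (X Y Z : E x) : E x :=
  c • (S.metric x Y Z • X - S.metric x X Z • Y + S.metric x (S.J x Y) Z • S.J x X
    - S.metric x (S.J x X) Z • S.J x Y + (2 * S.metric x X (S.J x Y)) • S.J x Z)

/-- The mean curvature vector `H = (1/2) trace h`, the trace being taken with respect to `g`. -/
def meanCurvature (x : M) : E x :=
  let b : Module.Basis (Fin 2) ℝ (TangentSpace (𝓡 2) x) :=
    (EuclideanSpace.basisFun (Fin 2) ℝ).toBasis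
  (1 / 2 : ℝ) • ∑ i, S.h (FiberBundle.extend (EuclideanSpace ℝ (Fin 2)) (b i))
    (FiberBundle.extend (EuclideanSpace ℝ (Fin 2))
      ((S.g x).dualBasis (S.g_nondegenerate x) b i)) x

def IsMinimal : Prop := ∀ x, S.meanCurvature x = 0

def IsFlat : Prop := ∀ X Y Z : ∀ x : M, TangentSpace (𝓡 2) x,
  SmoothField X → SmoothField Y → SmoothField Z → ∀ x, S.R X Y Z x = 0

/-- The equation of Gauss at the point `x` for the ambient curvature tensor `Rtilde c`. -/
def GaussAt (c : ℝ) (x : M) : Prop := ∀ X Y Z W : ∀ x : M, TangentSpace (𝓡 2) x,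
  SmoothField X → SmoothField Y → SmoothField Z → SmoothField W →
    S.g x (S.R X Y Z x) (W x) =
      S.metric x (S.Rtilde c x (S.ι x (X x)) (S.ι x (Y x)) (S.ι x (Z x))) (S.ι x (W x))
        + S.metric x (S.h X W x) (S.h Y Z x) - S.metric x (S.h X Z x) (S.h Y W x)

/-- The equation of Codazzi at the point `x` for the ambient curvature tensor `Rtilde c`. -/
def CodazziAt (c : ℝ) (x : M) : Prop := ∀ X Y Z : ∀ x : M, TangentSpace (𝓡 2) x,
  SmoothField X → SmoothField Y → SmoothField Z →
    S.nor x (S.Rtilde c x (S.ι x (X x)) (S.ι x (Y x)) (S.ι x (Z x))) =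
      S.nablaBarH X Y Z x - S.nablaBarH Y X Z x

/-- The equation of Ricci at the point `x` for the ambient curvature tensor `Rtilde c`. -/
def RicciAt (c : ℝ) (x : M) : Prop :=
  ∀ (X Y : ∀ x : M, TangentSpace (𝓡 2) x) (ξ η : ∀ x, E x),
  SmoothField X → SmoothField Y → SmoothSec ξ → SmoothSec η →
  S.IsNormal ξ → S.IsNormal η →
    S.metric x (S.RD X Y ξ x) (η x) =
      S.metric x (S.Rtilde c x (S.ι x (X x)) (S.ι x (Y x)) (ξ x)) (η x)
        + S.g x (S.shape ξ (S.shape η X) x - S.shape η (S.shape ξ X) x) (Y x)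

/-- `e₁, e₂` is a pseudo-orthonormal frame with `∇e₁ = ∇e₂ = 0` on the open set `U`, such as
`∂/∂x, ∂/∂y` for coordinates in which the metric of `M` is `-dx ⊗ dy - dy ⊗ dx`. -/
structure IsParallelNullFrame (U : Set M) (e₁ e₂ : ∀ x : M, TangentSpace (𝓡 2) x) : Prop where
  isOpen : IsOpen U
  contMDiffOn_fst : SmoothFieldOn e₁ U
  contMDiffOn_snd : SmoothFieldOn e₂ U
  null_fst : ∀ x ∈ U, S.g x (e₁ x) (e₁ x) = 0
  null_snd : ∀ x ∈ U, S.g x (e₂ x) (e₂ x) = 0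
  pairing : ∀ x ∈ U, S.g x (e₁ x) (e₂ x) = -1
  parallel_fst : ∀ x ∈ U, ∀ u, S.nabla e₁ x u = 0
  parallel_snd : ∀ x ∈ U, ∀ u, S.nabla e₂ x u = 0

/-- The tangential component `PX` of `JX`. -/
def P (x : M) (u : TangentSpace (𝓡 2) x) : TangentSpace (𝓡 2) x := S.tang x (S.J x (S.ι x u))

/-- The normal component `FX` of `JX`. -/
def F (x : M) (u : TangentSpace (𝓡 2) x) : E x := S.nor x (S.J x (S.ι x u))

/-- The Wirtinger angle `α` of the pseudo-orthonormal frame `e₁, e₂`, given by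
`sinh α = -⟨P e₁, e₂⟩`. -/
def wirtingerAngle (e₁ e₂ : ∀ x : M, TangentSpace (𝓡 2) x) (x : M) : ℝ :=
  Real.arsinh (-S.g x (S.P x (e₁ x)) (e₂ x))

/-- The normal fields `e₃ = (sech α) F e₁` (for `e = e₁`) and `e₄ = (sech α) F e₂`
(for `e = e₂`) of the adapted frame with Wirtinger angle `α`. -/
def adaptedNormal (α : M → ℝ) (e : ∀ x : M, TangentSpace (𝓡 2) x) (x : M) : E x :=
  (Real.cosh (α x))⁻¹ • S.F x (e x)

end LorentzianSurface

/-- The derivative `X f` of a function along a vector field. -/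
def dirDeriv {M : Type*} [TopologicalSpace M] [ChartedSpace (EuclideanSpace ℝ (Fin 2)) M]
    (X : ∀ x : M, TangentSpace (𝓡 2) x) (f : M → ℝ) (x : M) : ℝ :=
  mvfderiv (𝓡 2) f x (X x)

end

/-!
The equations of Gauss and Codazzi say that the curvature of the ambient connection agrees with
`R̃` when applied to three tangent vectors. Both tensors commute with `J` in the last argument,
and `TM + J(TM)` is the whole bundle because the Gram determinant of the normal components
`F e₁, F e₂` is, up to sign, `(1 + sinh² α)² = cosh⁴ α`. So the two tensors agree on normal
vectors as well, which is the equation of Ricci.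

For a parallel null frame, differentiating `sinh α = -⟨Je₁, e₂⟩` with `∇̃J = 0` expresses two of
the four coefficients of `h` through `α_x` and `α_y`. Substituting them, the only independent
component of the Gauss equation becomes the formula for `γλ`, and differentiating
`cosh α · α_x = ⟨h(e₁, e₁), Je₂⟩` once more with the Codazzi equation gives `α_{xy}`.
-/

section DualFamilies

theorem eq_sum_apply_smul_of_dual_family {K V n : Type*} [Field K] [AddCommGroup V] [Module K V]
    [FiniteDimensional K V] [Fintype n] {v : n → V} {φ : n → Module.Dual K V}
    (h_ne : Pairwise fun i j ↦ φ i (v j) = 0) (h_eq : ∀ i, φ i (v i) = 1)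
    (hcard : Fintype.card n = Module.finrank K V) (w : V) : w = ∑ i, φ i w • v i := by
  have hv : LinearIndependent K v := .of_pairwise_dual_eq_zero_one v φ h_ne h_eq
  have hw : w ∈ Submodule.span K (Set.range v) := by
    rw [hv.span_eq_top_of_card_eq_finrank' hcard]; trivial
  obtain ⟨c, rfl⟩ := (Submodule.mem_span_range_iff_exists_fun K).1 hw
  refine Finset.sum_congr rfl fun i _ ↦ ?_
  rw [map_sum, Finset.sum_eq_single i (fun j _ hj ↦ by simp [h_ne hj.symm]) (by simp)]
  simp [h_eq]

end DualFamilies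

section Sections

variable {B : Type*} [NormedAddCommGroup B] [NormedSpace ℝ B] [FiniteDimensional ℝ B]
  {H : Type*} [TopologicalSpace H] {I : ModelWithCorners ℝ B H}
  {M : Type*} [TopologicalSpace M] [ChartedSpace H M] [IsManifold I ∞ M] [T2Space M]
  {F : Type*} [NormedAddCommGroup F] [NormedSpace ℝ F]
  {V : M → Type*} [TopologicalSpace (TotalSpace F V)] [∀ x, AddCommGroup (V x)]
  [∀ x, Module ℝ (V x)] [∀ x, TopologicalSpace (V x)] [FiberBundle F V] [VectorBundle ℝ F V]

theorem exists_contMDiff_section_eventuallyEq {σ : ∀ x, V x} {U : Set M} {x : M}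
    (hσ : CMDiff[U] ∞ (T% σ)) (hU : U ∈ 𝓝 x) :
    ∃ τ : ∀ x, V x, CMDiff ∞ (T% τ) ∧ ∀ᶠ y in 𝓝 x, τ y = σ y := by
  obtain ⟨O, hOU, hO, hxO⟩ := mem_nhds_iff.1 hU
  obtain ⟨f, -, hf⟩ := (SmoothBumpFunction.nhds_basis_tsupport (I := I) x).mem_iff.1
    (hO.mem_nhds hxO)
  refine ⟨fun y ↦ f y • σ y, ContMDiffOn.smul_section_of_tsupport (ψ := f)
    f.contMDiff.contMDiffOn hO hf (hσ.mono hOU), ?_⟩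
  filter_upwards [f.eventuallyEq_one] with y hy
  simp [hy]

theorem exists_contMDiff_section_apply_eq [ContMDiffVectorBundle ∞ F V I]
    [∀ x, IsTopologicalAddGroup (V x)] [∀ x, ContinuousSMul ℝ (V x)] {x : M} (v : V x) :
    ∃ τ : ∀ x, V x, CMDiff ∞ (T% τ) ∧ τ x = v := by
  obtain ⟨U, hU, hv⟩ := FiberBundle.exists_contMDiffOn_extend (I := I) (k := ∞) (F := F) v
  obtain ⟨τ, hτ, h_eq⟩ := exists_contMDiff_section_eventuallyEq hv hU
  exact ⟨τ, hτ, by simp [h_eq.self_of_nhds]⟩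

end Sections

section Bracket

open VectorField

variable {B : Type*} [NormedAddCommGroup B] [NormedSpace ℝ B]
  {H : Type*} [TopologicalSpace H] {I : ModelWithCorners ℝ B H}
  {M : Type*} [TopologicalSpace M] [ChartedSpace H M]
  {X Y W : ∀ x : M, TangentSpace I x} {f : M → ℝ} {x : M}

theorem contMDiff_mvfderiv_apply [IsManifold I 1 M] {m n : WithTop ℕ∞} (hmn : m + 1 ≤ n)
    (hf : CMDiff n f) (hX : CMDiff m (T% X)) : CMDiff m (fun y ↦ d% f y (X y)) :=
  (contMDiff_snd_tangentBundle_modelSpace ℝ 𝓘(ℝ, ℝ)).comp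
    ((hf.contMDiff_tangentMap hmn).comp hX)

variable [CompleteSpace B]

theorem mlieBracket_smul_eventuallyEq [IsManifold I 2 M] (hf : CMDiff 1 f)
    (hW : CMDiffAt 1 (T% W) x) :
    mlieBracket I X (f • W) =ᶠ[𝓝 x] (fun y ↦ d% f y (X y)) • W + f • mlieBracket I X W := by
  have : IsManifold I 1 M := .of_le (n := 2) (by norm_num)
  filter_upwards [contMDiffAt_iff_contMDiffAt_nhds (by simp) |>.1 hW] with y hy
  exact mlieBracket_smul_right (hf.mdifferentiable (by simp) y) (hy.mdifferentiableAt (by simp))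

theorem mlieBracket_mlieBracket_smul [IsManifold I 3 M] (hf : CMDiff 2 f)
    (hY : CMDiff 2 (T% Y)) (hW : CMDiffAt 2 (T% W) x) :
    mlieBracket I X (mlieBracket I Y (f • W)) x =
      d% (fun y ↦ d% f y (Y y)) x (X x) • W x + d% f x (Y x) • mlieBracket I X W x
        + (d% f x (X x) • mlieBracket I Y W x + f x • mlieBracket I X (mlieBracket I Y W) x) := by
  have : IsManifold I 2 M := .of_le (n := 3) (by norm_num)
  have : IsManifold I 1 M := .of_le (n := 3) (by norm_num)
  have : IsManifold I ((2 : ℕ∞) + 1) M := .of_le (n := 3) (by norm_num)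
  have : IsManifold I (minSmoothness ℝ 2) M := by rwa [minSmoothness_of_isRCLikeNormedField]
  have hYf : MDiffAt (fun y ↦ d% f y (Y y)) x :=
    (contMDiff_mvfderiv_apply (m := 1) (by norm_num) hf (hY.of_le (by norm_num))).mdifferentiable
      (by simp) x
  have hf' : MDiffAt f x := hf.mdifferentiable (by simp) x
  have hW' : MDiffAt (T% W) x := hW.mdifferentiableAt (by simp)
  have hYW : MDiffAt (T% (mlieBracket I Y W)) x :=
    (ContMDiffAt.mlieBracket_vectorField (m := 1) (n := 2) hY.contMDiffAt hW
      (by rw [minSmoothness_of_isRCLikeNormedField]; norm_num)).mdifferentiableAt (by simp)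
  rw [Filter.EventuallyEq.mlieBracket_vectorField_eq (.refl _ X)
      (mlieBracket_smul_eventuallyEq (X := Y) (hf.of_le (by norm_num)) (hW.of_le (by norm_num))),
    mlieBracket_add_right (hYf.smul_section hW') (hf'.smul_section hYW),
    mlieBracket_smul_right hYf hW', mlieBracket_smul_right hf' hYW]

-- Subtract `f` times the Jacobi identity for `X, Y, W` from the one for `X, Y, f • W`.
theorem mvfderiv_mlieBracket [IsManifold I 3 M] (hf : CMDiff 2 f) (hX : CMDiff 2 (T% X))
    (hY : CMDiff 2 (T% Y)) (x : M) :
    d% f x (mlieBracket I X Y x) =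
      d% (fun y ↦ d% f y (Y y)) x (X x) - d% (fun y ↦ d% f y (X y)) x (Y x) := by
  have : IsManifold I (minSmoothness ℝ 3) M := by rwa [minSmoothness_of_isRCLikeNormedField]
  have : IsManifold I 2 M := .of_le (n := 3) (by norm_num)
  have : IsManifold I (2 + 1) M := .of_le (n := 3) (by norm_num)
  have key (w : TangentSpace I x) : (d% f x (mlieBracket I X Y x) -
      (d% (fun y ↦ d% f y (Y y)) x (X x) - d% (fun y ↦ d% f y (X y)) x (Y x))) • w = 0 := by
    set W := FiberBundle.extend B w
    have hW : CMDiffAt 2 (T% W) x := FiberBundle.contMDiffAt_extend I B w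
    have hfW : CMDiffAt 2 (T% (f • W)) x := hf.contMDiffAt.smul_section hW
    have hWx : W x = w := FiberBundle.extend_apply_self B w
    have jacobi {Z : ∀ y : M, TangentSpace I y} (hZ : CMDiffAt 2 (T% Z) x) :=
      leibniz_identity_mlieBracket_apply (I := I) (U := X) (V := Y) (W := Z) (x := x)
        (by rw [minSmoothness_of_isRCLikeNormedField]; exact hX.contMDiffAt)
        (by rw [minSmoothness_of_isRCLikeNormedField]; exact hY.contMDiffAt)
        (by rwa [minSmoothness_of_isRCLikeNormedField])
    have h := jacobi hfW
    rw [mlieBracket_mlieBracket_smul hf hY hW, mlieBracket_mlieBracket_smul hf hX hW,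
      mlieBracket_smul_right (hf.mdifferentiable (by simp) x) (hW.mdifferentiableAt (by simp)),
      jacobi hW, hWx] at h
    rw [← neg_eq_zero, ← sub_eq_zero.2 h]
    module
  by_contra h_ne
  have h_zero (w : TangentSpace I x) : w = 0 :=
    (smul_eq_zero.1 (key w)).resolve_left (sub_ne_zero.2 h_ne)
  exact h_ne (by rw [h_zero (mlieBracket I X Y x), h_zero (X x), h_zero (Y x)]; simp)

end Bracket

section BilinearForm

variable {B : Type*} [NormedAddCommGroup B] [NormedSpace ℝ B]
  {H : Type*} [TopologicalSpace H] {I : ModelWithCorners ℝ B H}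
  {M : Type*} [TopologicalSpace M] [ChartedSpace H M]
  {F : Type*} [NormedAddCommGroup F] [NormedSpace ℝ F]
  {V : M → Type*} [TopologicalSpace (TotalSpace F V)] [∀ x, AddCommGroup (V x)]
  [∀ x, Module ℝ (V x)] [∀ x, TopologicalSpace (V x)] [FiberBundle F V] [VectorBundle ℝ F V]
  {G : ∀ x, V x →L[ℝ] V x →L[ℝ] ℝ} {σ τ : ∀ x, V x} {x : M} {U : Set M}
  (hG : ContMDiff I (I.prod 𝓘(ℝ, F →L[ℝ] F →L[ℝ] ℝ)) ∞
    (fun x ↦ TotalSpace.mk' (F →L[ℝ] F →L[ℝ] ℝ) x (G x)))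
include hG

theorem contMDiffOn_form_apply (hσ : CMDiff[U] ∞ (T% σ)) (hτ : CMDiff[U] ∞ (T% τ)) :
    CMDiff[U] ∞ (fun y ↦ G y (σ y) (τ y)) := fun x hx ↦ by
  have h := ContMDiffWithinAt.clm_bundle_apply₂ (F₃ := ℝ) (E₃ := Bundle.Trivial M ℝ)
    (hG.contMDiffAt (x := x)).contMDiffWithinAt (hσ x hx) (hτ x hx)
  exact (contMDiffWithinAt_totalSpace.1 h).2

theorem contMDiff_form_apply (hσ : CMDiff ∞ (T% σ)) (hτ : CMDiff ∞ (T% τ)) :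
    CMDiff ∞ (fun y ↦ G y (σ y) (τ y)) :=
  contMDiffOn_univ.1 (contMDiffOn_form_apply hG (contMDiffOn_univ.2 hσ) (contMDiffOn_univ.2 hτ))

theorem mdifferentiableAt_form_apply (hσ : MDiffAt (T% σ) x) (hτ : MDiffAt (T% τ) x) :
    MDiffAt (fun y ↦ G y (σ y) (τ y)) x := by
  have h := MDifferentiableAt.clm_bundle_apply₂ (F₃ := ℝ) (E₃ := Bundle.Trivial M ℝ)
    (hG.mdifferentiable (by simp) x) hσ hτ
  exact ((mdifferentiableAt_totalSpace _ _).1 h).2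

end BilinearForm

section CovariantDerivative

open VectorField

variable {B : Type*} [NormedAddCommGroup B] [NormedSpace ℝ B]
  {H : Type*} [TopologicalSpace H] {I : ModelWithCorners ℝ B H}
  {M : Type*} [TopologicalSpace M] [ChartedSpace H M]
  {F : Type*} [NormedAddCommGroup F] [NormedSpace ℝ F]
  {V : M → Type*} [TopologicalSpace (TotalSpace F V)] [∀ x, AddCommGroup (V x)]
  [∀ x, Module ℝ (V x)] [∀ x, TopologicalSpace (V x)] [∀ x, IsTopologicalAddGroup (V x)]
  [∀ x, ContinuousSMul ℝ (V x)] [FiberBundle F V]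
  {cov : CovariantDerivative I F V} {X Y : ∀ x : M, TangentSpace I x} {σ τ : ∀ x, V x} {x : M}

theorem covariantDerivative_add_apply [VectorBundle ℝ F V] (hσ : MDiffAt (T% σ) x)
    (hτ : MDiffAt (T% τ) x) (u : TangentSpace I x) :
    cov (fun y ↦ σ y + τ y) x u = cov σ x u + cov τ x u :=
  congrArg (fun L : TangentSpace I x →L[ℝ] V x ↦ L u)
    (cov.isCovariantDerivativeOnUniv.add hσ hτ)

theorem covariantDerivative_sub_apply [VectorBundle ℝ F V] (hσ : MDiffAt (T% σ) x)
    (hτ : MDiffAt (T% τ) x) (u : TangentSpace I x) :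
    cov (fun y ↦ σ y - τ y) x u = cov σ x u - cov τ x u := by
  have h := covariantDerivative_add_apply (cov := cov) (σ := fun y ↦ σ y - τ y)
    (mdifferentiableAt_sub_section hσ hτ) hτ u
  simp only [sub_add_cancel] at h
  rw [h, add_sub_cancel_right]

theorem covariantDerivative_congr_of_eventuallyEq (hσ : MDiffAt (T% σ) x)
    (h : ∀ᶠ y in 𝓝 x, σ y = τ y) : cov σ x = cov τ x :=
  cov.isCovariantDerivativeOnUniv.congr_of_eventuallyEq hσ
    (MDifferentiableAt.congr_of_eventuallyEq hσ
      (by filter_upwards [h] with y hy; simp only [hy])) Filter.univ_mem h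

/-- The curvature `∇_X ∇_Y σ - ∇_Y ∇_X σ - ∇_[X,Y] σ` of a covariant derivative. -/
noncomputable def covariantCurvature (cov : CovariantDerivative I F V)
    (X Y : ∀ x : M, TangentSpace I x) (σ : ∀ x, V x) (x : M) : V x :=
  cov (fun y ↦ cov σ y (Y y)) x (X x) - cov (fun y ↦ cov σ y (X y)) x (Y x)
    - cov σ x (mlieBracket I X Y x)

variable [IsManifold I ∞ M] [VectorBundle ℝ F V] (hcov : cov.ContMDiffCovariantDerivative ∞)

include hcov

theorem contMDiff_covariantDerivative_apply (hσ : CMDiff ∞ (T% σ)) (hX : CMDiff ∞ (T% X)) :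
    CMDiff ∞ (T% fun y ↦ cov σ y (X y)) :=
  (contMDiffOn_univ.1 (hcov.contMDiff.contMDiff (contMDiffOn_univ.2
    (by simpa using! hσ)))).clm_bundle_apply hX

theorem mdifferentiableAt_covariantDerivative_apply (hσ : CMDiff ∞ (T% σ))
    (hX : CMDiff ∞ (T% X)) : MDiffAt (T% fun y ↦ cov σ y (X y)) x :=
  (contMDiff_covariantDerivative_apply hcov hσ hX).mdifferentiable (by simp) x

theorem covariantCurvature_sub (hX : CMDiff ∞ (T% X)) (hY : CMDiff ∞ (T% Y))
    (hσ : CMDiff ∞ (T% σ)) (hτ : CMDiff ∞ (T% τ)) :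
    covariantCurvature cov X Y (fun y ↦ σ y - τ y) x =
      covariantCurvature cov X Y σ x - covariantCurvature cov X Y τ x := by
  have first (y : M) (u : TangentSpace I y) :
      cov (fun y ↦ σ y - τ y) y u = cov σ y u - cov τ y u :=
    covariantDerivative_sub_apply (hσ.mdifferentiable (by simp) y)
      (hτ.mdifferentiable (by simp) y) u
  have second {Z : ∀ x : M, TangentSpace I x} (hZ : CMDiff ∞ (T% Z)) (u : TangentSpace I x) :=
    covariantDerivative_sub_apply (cov := cov)
      (mdifferentiableAt_covariantDerivative_apply hcov (x := x) hσ hZ)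
      (mdifferentiableAt_covariantDerivative_apply hcov hτ hZ) u
  simp only [covariantCurvature, first, second hX, second hY]
  abel

theorem covariantCurvature_parallel_endomorphism {T : ∀ x, V x →L[ℝ] V x}
    (hT : ∀ (x : M) (σ : ∀ x, V x), MDiffAt (T% σ) x →
      ∀ u : TangentSpace I x, cov (fun y ↦ T y (σ y)) x u = T x (cov σ x u))
    (hX : CMDiff ∞ (T% X)) (hY : CMDiff ∞ (T% Y)) (hσ : CMDiff ∞ (T% σ)) :
    covariantCurvature cov X Y (fun y ↦ T y (σ y)) x = T x (covariantCurvature cov X Y σ x) := by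
  have first (y : M) (u : TangentSpace I y) : cov (fun y ↦ T y (σ y)) y u = T y (cov σ y u) :=
    hT y σ (hσ.mdifferentiable (by simp) y) u
  have second {Z : ∀ x : M, TangentSpace I x} (hZ : CMDiff ∞ (T% Z)) :=
    hT x _ (mdifferentiableAt_covariantDerivative_apply hcov hσ hZ)
  simp only [covariantCurvature, first, second hX, second hY, map_sub]

variable {G : ∀ x, V x →L[ℝ] V x →L[ℝ] ℝ}
  (hG : ContMDiff I (I.prod 𝓘(ℝ, F →L[ℝ] F →L[ℝ] ℝ)) ∞
    (fun x ↦ TotalSpace.mk' (F →L[ℝ] F →L[ℝ] ℝ) x (G x)))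
  (hGcov : ∀ (x : M) (σ τ : ∀ x, V x), MDiffAt (T% σ) x → MDiffAt (T% τ) x →
    ∀ u : TangentSpace I x, d% (fun y ↦ G y (σ y) (τ y)) x u =
      G x (cov σ x u) (τ x) + G x (σ x) (cov τ x u))
include hG hGcov

theorem mvfderiv_mvfderiv_parallel_form (hY : CMDiff ∞ (T% Y)) (hσ : CMDiff ∞ (T% σ))
    (hτ : CMDiff ∞ (T% τ)) (u : TangentSpace I x) :
    d% (fun y ↦ d% (fun z ↦ G z (σ z) (τ z)) y (Y y)) x u =
      (G x (cov (fun y ↦ cov σ y (Y y)) x u) (τ x) + G x (cov σ x (Y x)) (cov τ x u)) +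
      (G x (cov σ x u) (cov τ x (Y x)) + G x (σ x) (cov (fun y ↦ cov τ y (Y y)) x u)) := by
  have dσ (y : M) : MDiffAt (T% σ) y := hσ.mdifferentiable (by simp) y
  have dτ (y : M) : MDiffAt (T% τ) y := hτ.mdifferentiable (by simp) y
  have dYσ : MDiffAt (T% fun y ↦ cov σ y (Y y)) x :=
    mdifferentiableAt_covariantDerivative_apply hcov hσ hY
  have dYτ : MDiffAt (T% fun y ↦ cov τ y (Y y)) x :=
    mdifferentiableAt_covariantDerivative_apply hcov hτ hY
  simp only [hGcov _ σ τ (dσ _) (dτ _)]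
  rw [mvfderiv_fun_add (mdifferentiableAt_form_apply hG dYσ (dτ x))
      (mdifferentiableAt_form_apply hG (dσ x) dYτ), add_apply,
    hGcov x _ τ dYσ (dτ x), hGcov x σ _ (dσ x) dYτ]

theorem covariantCurvature_skew_of_parallel_form [CompleteSpace B] (hX : CMDiff ∞ (T% X))
    (hY : CMDiff ∞ (T% Y)) (hσ : CMDiff ∞ (T% σ)) (hτ : CMDiff ∞ (T% τ)) :
    G x (covariantCurvature cov X Y σ x) (τ x) =
      -G x (σ x) (covariantCurvature cov X Y τ x) := by
  have : IsManifold I 3 M := .of_le (n := ∞) (by norm_cast)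
  have bracket := mvfderiv_mlieBracket
    (f := fun y ↦ G y (σ y) (τ y)) ((contMDiff_form_apply hG hσ hτ).of_le (by norm_cast))
    (hX.of_le (by norm_cast)) (hY.of_le (by norm_cast)) x
  rw [mvfderiv_mvfderiv_parallel_form hcov hG hGcov hX hσ hτ,
    mvfderiv_mvfderiv_parallel_form hcov hG hGcov hY hσ hτ,
    hGcov x σ τ (hσ.mdifferentiable (by simp) x) (hτ.mdifferentiable (by simp) x)] at bracket
  simp only [covariantCurvature, map_sub, sub_apply]
  linarith

end CovariantDerivative

section

variable {M : Type*} [TopologicalSpace M] [ChartedSpace (EuclideanSpace ℝ (Fin 2)) M]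

theorem SmoothSec.diffSecAt {E : M → Type*} [TopologicalSpace (TotalSpace R4 E)]
    [∀ x, TopologicalSpace (E x)] [FiberBundle R4 E]
    {σ : ∀ x : M, E x} {x : M} (hσ : SmoothSec σ) : DiffSecAt σ x :=
  ContMDiff.mdifferentiable hσ (by simp) x

variable [IsManifold (𝓡 2) ∞ M] {X : ∀ x : M, TangentSpace (𝓡 2) x} {x : M}

theorem SmoothField.diffFieldAt (hX : SmoothField X) : DiffFieldAt X x :=
  ContMDiff.mdifferentiable hX (by simp) x

theorem SmoothFieldOn.diffFieldAt {U : Set M} (hX : SmoothFieldOn X U) (hU : U ∈ 𝓝 x) :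
    DiffFieldAt X x :=
  (ContMDiffOn.contMDiffAt hX hU).mdifferentiableAt (by simp)

theorem SmoothFieldOn.exists_smoothField_eventuallyEq [T2Space M] {U : Set M}
    (hX : SmoothFieldOn X U) (hU : U ∈ 𝓝 x) :
    ∃ X' : ∀ x : M, TangentSpace (𝓡 2) x, SmoothField X' ∧ ∀ᶠ y in 𝓝 x, X' y = X y :=
  exists_contMDiff_section_eventuallyEq hX hU

theorem exists_smoothField_apply_eq [T2Space M] (u : TangentSpace (𝓡 2) x) :
    ∃ X : ∀ x : M, TangentSpace (𝓡 2) x, SmoothField X ∧ X x = u :=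
  exists_contMDiff_section_apply_eq (F := EuclideanSpace ℝ (Fin 2)) u

end

section DirDeriv

variable {M : Type*} [TopologicalSpace M] [ChartedSpace (EuclideanSpace ℝ (Fin 2)) M]
  {X : ∀ x : M, TangentSpace (𝓡 2) x} {f f' : M → ℝ} {x : M}

theorem dirDeriv_congr (h : f =ᶠ[𝓝 x] f') : dirDeriv X f x = dirDeriv X f' x :=
  congrArg (fun L : TangentSpace (𝓡 2) x →L[ℝ] ℝ ↦ L (X x))
    (h.mfderiv_eq (I := 𝓡 2) (I' := 𝓘(ℝ, ℝ)))

theorem dirDeriv_neg : dirDeriv X (fun y ↦ -f y) x = -dirDeriv X f x := by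
  rw [dirDeriv, mvfderiv_fun_neg]
  rfl

theorem dirDeriv_mul (hf : MDifferentiableAt (𝓡 2) 𝓘(ℝ, ℝ) f x)
    (hf' : MDifferentiableAt (𝓡 2) 𝓘(ℝ, ℝ) f' x) :
    dirDeriv X (fun y ↦ f y * f' y) x = f x * dirDeriv X f' x + f' x * dirDeriv X f x := by
  rw [dirDeriv, mvfderiv_fun_mul hf hf']
  rfl

theorem dirDeriv_comp {φ : ℝ → ℝ} {φ' : ℝ} (hφ : HasDerivAt φ φ' (f x))
    (hf : MDifferentiableAt (𝓡 2) 𝓘(ℝ, ℝ) f x) :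
    dirDeriv X (fun y ↦ φ (f y)) x = φ' * dirDeriv X f x := by
  have hchain := (hφ.hasFDerivAt.hasMFDerivAt.comp x hf.hasMFDerivAt).mfderiv
  have happly := congrArg (fun L : TangentSpace (𝓡 2) x →L[ℝ] ℝ ↦ L (X x)) hchain
  exact happly.trans (mul_comm (dirDeriv X f x) φ')

end DirDeriv

namespace LorentzianSurface

variable {M : Type*} [TopologicalSpace M] [ChartedSpace (EuclideanSpace ℝ (Fin 2)) M]
  [IsManifold (𝓡 2) ∞ M]
  {E : M → Type*} [TopologicalSpace (TotalSpace R4 E)] [∀ x, AddCommGroup (E x)]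
  [∀ x, Module ℝ (E x)] [∀ x, TopologicalSpace (E x)] [∀ x, IsTopologicalAddGroup (E x)]
  [∀ x, ContinuousSMul ℝ (E x)] [FiberBundle R4 E] [VectorBundle ℝ R4 E]
  [ContMDiffVectorBundle ∞ R4 E (𝓡 2)]
  (S : LorentzianSurface M E)

section Pointwise

variable {x : M}

theorem g_symm (u v : TangentSpace (𝓡 2) x) : S.g x u v = S.g x v u := by
  rw [g_apply, g_apply, S.metric_symm]

theorem metric_J_left (v w : E x) : S.metric x (S.J x v) w = -S.metric x v (S.J x w) := by
  rw [← S.J_isometry x v, S.J_sq, map_neg, neg_neg]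

theorem ι_tang_add_nor (w : E x) : S.ι x (S.tang x w) + S.nor x w = w :=
  add_sub_cancel _ _

theorem eq_of_g_eq {t t' : TangentSpace (𝓡 2) x} (h : ∀ u, S.g x t u = S.g x t' u) : t = t' :=
  sub_eq_zero.1 <| (S.g_nondegenerate x).1 _ fun u ↦ by simp [h u]

theorem tang_eq {w : E x} {t : TangentSpace (𝓡 2) x}
    (h : ∀ u, S.g x t u = S.metric x w (S.ι x u)) : S.tang x w = t :=
  S.eq_of_g_eq fun u ↦ by rw [g_tang, h]

theorem tang_zero : S.tang x 0 = 0 :=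
  S.tang_eq fun u ↦ by simp

theorem tang_add (v w : E x) : S.tang x (v + w) = S.tang x v + S.tang x w :=
  S.tang_eq fun u ↦ by simp [g_tang]

theorem tang_sub (v w : E x) : S.tang x (v - w) = S.tang x v - S.tang x w :=
  S.tang_eq fun u ↦ by simp [g_tang]

theorem tang_smul (a : ℝ) (w : E x) : S.tang x (a • w) = a • S.tang x w :=
  S.tang_eq fun u ↦ by simp [g_tang]

theorem tang_ι (u : TangentSpace (𝓡 2) x) : S.tang x (S.ι x u) = u :=
  S.tang_eq fun v ↦ S.g_apply x u v

theorem nor_zero : S.nor x 0 = 0 := by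
  simp [nor, tang_zero]

theorem nor_add (v w : E x) : S.nor x (v + w) = S.nor x v + S.nor x w := by
  simp only [nor, tang_add, map_add]; abel

theorem nor_sub (v w : E x) : S.nor x (v - w) = S.nor x v - S.nor x w := by
  simp only [nor, tang_sub, map_sub]; abel

theorem nor_smul (a : ℝ) (w : E x) : S.nor x (a • w) = a • S.nor x w := by
  simp only [nor, tang_smul, map_smul, smul_sub]

theorem nor_ι (u : TangentSpace (𝓡 2) x) : S.nor x (S.ι x u) = 0 := by
  simp [nor, tang_ι]

theorem metric_nor_left_of_normal {w n : E x} (hn : ∀ u, S.metric x n (S.ι x u) = 0) :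
    S.metric x (S.nor x w) n = S.metric x w n := by
  simp [nor, S.metric_symm x (S.ι x _), hn]

theorem eq_combination_of_g_dual {a b a' b' : TangentSpace (𝓡 2) x}
    (haa : S.g x a a' = 1) (hba : S.g x b a' = 0) (hab : S.g x a b' = 0) (hbb : S.g x b b' = 1)
    (w : TangentSpace (𝓡 2) x) : w = S.g x w a' • a + S.g x w b' • b := by
  have hcard : Fintype.card (Fin 2) = Module.finrank ℝ (TangentSpace (𝓡 2) x) := by
    change _ = Module.finrank ℝ (EuclideanSpace ℝ (Fin 2))
    simp
  have h := eq_sum_apply_smul_of_dual_family (v := ![a, b])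
    (φ := ![(S.g x).flip a', (S.g x).flip b'])
    (by intro i j; fin_cases i <;> fin_cases j <;> simp [hba, hab])
    (by intro i; fin_cases i <;> simp [haa, hbb]) hcard w
  simpa using h

theorem J_ι (u : TangentSpace (𝓡 2) x) : S.J x (S.ι x u) = S.ι x (S.P x u) + S.F x u :=
  (S.ι_tang_add_nor _).symm

theorem g_P_left (u v : TangentSpace (𝓡 2) x) :
    S.g x (S.P x u) v = -S.g x u (S.P x v) := by
  rw [S.g_symm u, P, P, g_tang, g_tang, metric_J_left, S.metric_symm]

theorem g_P_self (u : TangentSpace (𝓡 2) x) : S.g x (S.P x u) u = 0 := by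
  have h := S.g_P_left u u
  rw [S.g_symm u] at h
  linarith

theorem metric_F_ι (u v : TangentSpace (𝓡 2) x) : S.metric x (S.F x u) (S.ι x v) = 0 :=
  S.metric_nor_ι x _ v

theorem metric_F_F (u v : TangentSpace (𝓡 2) x) :
    S.metric x (S.F x u) (S.F x v) = S.g x u v - S.g x (S.P x u) (S.P x v) := by
  have h := S.J_isometry x (S.ι x u) (S.ι x v)
  simp only [J_ι, map_add, add_apply, metric_F_ι, S.metric_symm x (S.ι x _) (S.F x _)] at h
  rw [g_apply, g_apply, ← h]
  ring

theorem metric_J_ι_of_normal {w : E x} (hw : ∀ u, S.metric x w (S.ι x u) = 0)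
    (u : TangentSpace (𝓡 2) x) : S.metric x w (S.J x (S.ι x u)) = S.metric x w (S.F x u) := by
  rw [J_ι, map_add, hw, zero_add]

theorem F_smul (r : ℝ) (u : TangentSpace (𝓡 2) x) : S.F x (r • u) = r • S.F x u := by
  rw [F, map_smul, map_smul, nor_smul, F]

theorem metric_J_F_of_normal {w : E x} (hw : ∀ u, S.metric x w (S.ι x u) = 0)
    (u : TangentSpace (𝓡 2) x) :
    S.metric x w (S.J x (S.F x u)) = -S.metric x w (S.F x (S.P x u)) := by
  have hF : S.F x u = S.J x (S.ι x u) - S.ι x (S.P x u) := rfl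
  rw [hF, map_sub, S.J_sq, map_sub, map_neg, hw, S.metric_J_ι_of_normal hw, neg_zero, zero_sub]

theorem Rtilde_J (c : ℝ) (X Y Z : E x) :
    S.Rtilde c x X Y (S.J x Z) = S.J x (S.Rtilde c x X Y Z) := by
  have hJ (V : E x) : S.metric x V (S.J x Z) = -S.metric x (S.J x V) Z := by
    rw [metric_J_left, neg_neg]
  simp only [Rtilde, S.J_isometry, S.J_sq, map_smul, map_add, map_sub, hJ]
  module

theorem Rtilde_sub (c : ℝ) (X Y Z W : E x) :
    S.Rtilde c x X Y (Z - W) = S.Rtilde c x X Y Z - S.Rtilde c x X Y W := by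
  simp only [Rtilde, map_sub]
  module

theorem nor_Rtilde_ι (c : ℝ) (X Y Z : TangentSpace (𝓡 2) x) :
    S.nor x (S.Rtilde c x (S.ι x X) (S.ι x Y) (S.ι x Z)) =
      c • (S.g x (S.P x Y) Z • S.F x X - S.g x (S.P x X) Z • S.F x Y
        + (2 * S.g x X (S.P x Y)) • S.F x Z) := by
  simp only [Rtilde, nor_add, nor_sub, nor_smul, nor_ι, F, P, g_tang, S.g_symm X,
    S.metric_symm x (S.ι x X) (S.J x _)]
  module

theorem metric_Rtilde_ι (c : ℝ) (X Y Z W : TangentSpace (𝓡 2) x) :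
    S.metric x (S.Rtilde c x (S.ι x X) (S.ι x Y) (S.ι x Z)) (S.ι x W) =
      c * (S.g x Y Z * S.g x X W - S.g x X Z * S.g x Y W
        + S.g x (S.P x Y) Z * S.g x (S.P x X) W - S.g x (S.P x X) Z * S.g x (S.P x Y) W
        + 2 * S.g x X (S.P x Y) * S.g x (S.P x Z) W) := by
  simp only [Rtilde, P, g_tang, S.g_symm X (S.tang x _), S.metric_symm x (S.ι x X) (S.J x _),
    map_add, map_sub, map_smul, add_apply, sub_apply, smul_apply, smul_eq_mul]
  rfl

/-- The tangent vectors `a, b` form a pseudo-orthonormal basis of the tangent plane: both are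
null and `⟨a, b⟩ = -1`. -/
structure IsNullPair (a b : TangentSpace (𝓡 2) x) : Prop where
  null_fst : S.g x a a = 0
  null_snd : S.g x b b = 0
  pairing : S.g x a b = -1

variable (x) in
theorem exists_isNullPair : ∃ a b : TangentSpace (𝓡 2) x, S.IsNullPair a b := by
  obtain ⟨u, v, hu, hv, huv⟩ := S.lorentzian x
  rw [← g_apply] at hu hv huv
  have hvu := S.g_symm v u
  refine ⟨u + v, (1 / 2 : ℝ) • (u - v), ⟨?_, ?_, ?_⟩⟩ <;>
    norm_num [hu, hv, huv, hvu]

/-- The number `-⟨Ja, b⟩`, which is the hyperbolic sine of the Wirtinger angle if `a, b` is a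
pseudo-orthonormal basis. -/
noncomputable def sinhAngle (a b : TangentSpace (𝓡 2) x) : ℝ := -S.g x (S.P x a) b

namespace IsNullPair

variable {S} {a b : TangentSpace (𝓡 2) x} (hab : S.IsNullPair a b)
include hab

theorem pairing_swap : S.g x b a = -1 := by rw [g_symm, hab.pairing]

theorem eq_combination (w : TangentSpace (𝓡 2) x) : w = (-S.g x w b) • a + (-S.g x w a) • b := by
  simpa using S.eq_combination_of_g_dual (a := a) (b := b) (a' := -b) (b' := -a)
    (by simp [hab.pairing]) (by simp [hab.null_snd]) (by simp [hab.null_fst])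
    (by simp [hab.pairing_swap]) w

theorem P_fst : S.P x a = S.sinhAngle a b • a := by
  have h := hab.eq_combination (S.P x a)
  rwa [g_P_self, neg_zero, zero_smul, add_zero] at h

theorem P_snd : S.P x b = -(S.sinhAngle a b • b) := by
  have h := hab.eq_combination (S.P x b)
  rwa [g_P_self, neg_zero, zero_smul, zero_add, g_P_left, neg_neg, g_symm, ← neg_neg (S.g x _ _),
    neg_smul] at h

theorem metric_F_fst_fst : S.metric x (S.F x a) (S.F x a) = 0 := by
  simp [metric_F_F, hab.P_fst, hab.null_fst]

theorem metric_F_snd_snd : S.metric x (S.F x b) (S.F x b) = 0 := by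
  simp [metric_F_F, hab.P_snd, hab.null_snd]

theorem metric_F_fst_snd : S.metric x (S.F x a) (S.F x b) = -(1 + S.sinhAngle a b ^ 2) := by
  simp only [metric_F_F, hab.P_fst, hab.P_snd, hab.pairing, map_neg, map_smul,
    LinearMap.smul_apply, smul_eq_mul]
  ring

theorem metric_F_snd_fst : S.metric x (S.F x b) (S.F x a) = -(1 + S.sinhAngle a b ^ 2) := by
  rw [S.metric_symm, hab.metric_F_fst_snd]

theorem eq_combination_ι_F (w : E x) :
    w = (-S.metric x w (S.ι x b)) • S.ι x a + (-S.metric x w (S.ι x a)) • S.ι x b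
      + (-(S.metric x w (S.F x b) / (1 + S.sinhAngle a b ^ 2))) • S.F x a
      + (-(S.metric x w (S.F x a) / (1 + S.sinhAngle a b ^ 2))) • S.F x b := by
  have : FiniteDimensional ℝ (E x) := VectorBundle.finiteDimensional ℝ R4 E x
  have hcard : Fintype.card (Fin 4) = Module.finrank ℝ (E x) := by
    rw [(VectorBundle.continuousLinearEquivAt ℝ R4 E x).toLinearEquiv.finrank_eq]
    simp
  have hs : 1 + S.sinhAngle a b ^ 2 ≠ 0 := by positivity
  let dual : Fin 4 → E x := ![-S.ι x b, -S.ι x a, -(1 + S.sinhAngle a b ^ 2)⁻¹ • S.F x b,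
    -(1 + S.sinhAngle a b ^ 2)⁻¹ • S.F x a]
  have hιF (u v) : S.metric x (S.ι x u) (S.F x v) = 0 := by rw [S.metric_symm, metric_F_ι]
  have h := eq_sum_apply_smul_of_dual_family (v := ![S.ι x a, S.ι x b, S.F x a, S.F x b])
    (φ := fun i ↦ (S.metric x (dual i) : E x →ₗ[ℝ] ℝ))
    (by
      intro i j
      fin_cases i <;> fin_cases j <;>
        simp [dual, ← g_apply, hab.null_fst, hab.null_snd, metric_F_ι, hιF,
          hab.metric_F_fst_fst, hab.metric_F_snd_snd])
    (by
      intro i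
      fin_cases i <;>
        simp [dual, ← g_apply, hab.pairing, hab.pairing_swap, hab.metric_F_fst_snd,
          hab.metric_F_snd_fst, hs, -neg_add_rev])
    hcard w
  simpa [dual, Fin.sum_univ_four, div_eq_inv_mul, S.metric_symm x w] using h

theorem eq_combination_F {w : E x} (hw : ∀ u, S.metric x w (S.ι x u) = 0) :
    w = (-(S.metric x w (S.J x (S.ι x b)) / (1 + S.sinhAngle a b ^ 2))) • S.F x a +
      (-(S.metric x w (S.J x (S.ι x a)) / (1 + S.sinhAngle a b ^ 2))) • S.F x b := by
  conv_lhs => rw [hab.eq_combination_ι_F w]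
  simp [hw, S.metric_J_ι_of_normal hw]

theorem metric_combination_F (p q r t : ℝ) :
    S.metric x (p • S.F x a + q • S.F x b) (r • S.F x a + t • S.F x b) =
      -(1 + S.sinhAngle a b ^ 2) * (p * t + q * r) := by
  simp only [map_add, map_smul, add_apply, smul_apply, smul_eq_mul, hab.metric_F_fst_fst,
    hab.metric_F_fst_snd, hab.metric_F_snd_fst, hab.metric_F_snd_snd]
  ring

theorem g_combination (p q r t : ℝ) :
    S.g x (p • a + q • b) (r • a + t • b) = -(p * t + q * r) := by
  simp only [map_add, map_smul, LinearMap.add_apply, LinearMap.smul_apply, smul_eq_mul,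
    hab.null_fst, hab.null_snd, hab.pairing, hab.pairing_swap]
  ring

theorem P_combination (p q : ℝ) :
    S.P x (p • a + q • b) = (S.sinhAngle a b * p) • a + (-(S.sinhAngle a b * q)) • b := by
  have hP : S.P x (p • a + q • b) = p • S.P x a + q • S.P x b := by
    simp only [P, map_add, map_smul, tang_add, tang_smul]
  rw [hP, hab.P_fst, hab.P_snd]
  module

theorem metric_combination_F_J (p q r t : ℝ) :
    S.metric x (p • S.F x a + q • S.F x b) (S.J x (r • S.F x a + t • S.F x b)) =
      (1 + S.sinhAngle a b ^ 2) * S.sinhAngle a b * (q * r - p * t) := by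
  have hFa (n : E x) (hn : ∀ u, S.metric x n (S.ι x u) = 0) :
      S.metric x n (S.J x (S.F x a)) = -(S.sinhAngle a b * S.metric x n (S.F x a)) := by
    rw [S.metric_J_F_of_normal hn, hab.P_fst, F_smul, map_smul, smul_eq_mul]
  have hFb (n : E x) (hn : ∀ u, S.metric x n (S.ι x u) = 0) :
      S.metric x n (S.J x (S.F x b)) = S.sinhAngle a b * S.metric x n (S.F x b) := by
    rw [S.metric_J_F_of_normal hn, hab.P_snd, ← neg_smul, F_smul, map_smul, smul_eq_mul]
    ring
  simp only [map_add, map_smul, add_apply, smul_apply, smul_eq_mul, hFa _ (S.metric_F_ι _),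
    hFb _ (S.metric_F_ι _), hab.metric_F_fst_fst, hab.metric_F_fst_snd, hab.metric_F_snd_fst,
    hab.metric_F_snd_snd]
  ring

theorem nor_Rtilde_snd_fst_fst (c : ℝ) :
    S.nor x (S.Rtilde c x (S.ι x b) (S.ι x a) (S.ι x a)) =
      (-(3 * c * S.sinhAngle a b)) • S.F x a := by
  rw [nor_Rtilde_ι, g_P_self, g_P_left, hab.P_fst, map_smul, hab.pairing_swap, smul_eq_mul]
  module

theorem metric_Rtilde_combination (c : ℝ) (p₁ q₁ p₂ q₂ p₃ q₃ p₄ q₄ : ℝ) :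
    S.metric x (S.Rtilde c x (S.ι x (p₁ • a + q₁ • b)) (S.ι x (p₂ • a + q₂ • b))
      (S.ι x (p₃ • a + q₃ • b))) (S.ι x (p₄ • a + q₄ • b)) =
    (p₁ * q₂ - q₁ * p₂) * (p₄ * q₃ - q₄ * p₃) * (c * (3 * S.sinhAngle a b ^ 2 - 1)) := by
  simp only [metric_Rtilde_ι, hab.P_combination, hab.g_combination]
  ring

end IsNullPair

theorem exists_eq_J_ι_sub_ι {w : E x} (hw : ∀ u, S.metric x w (S.ι x u) = 0) :
    ∃ u v, w = S.J x (S.ι x u) - S.ι x v := by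
  obtain ⟨a, b, hab⟩ := S.exists_isNullPair x
  obtain ⟨p, q, hpq⟩ : ∃ p q : ℝ, w = p • S.F x a + q • S.F x b := ⟨_, _, hab.eq_combination_F hw⟩
  refine ⟨p • a + q • b, S.P x (p • a + q • b), ?_⟩
  rw [J_ι, add_sub_cancel_left, hpq]
  simp only [F, map_add, map_smul, nor_add, nor_smul]

theorem eq_of_metric_eq {w w' : E x} (h : ∀ v, S.metric x w v = S.metric x w' v) : w = w' := by
  obtain ⟨a, b, hab⟩ := S.exists_isNullPair x
  rw [hab.eq_combination_ι_F w, hab.eq_combination_ι_F w']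
  simp only [h]

end Pointwise

section Regularity

variable {x : M} {X Y Z W : ∀ x : M, TangentSpace (𝓡 2) x} {σ τ : ∀ x, E x}

theorem smoothSec_ι (hY : SmoothField Y) : SmoothSec fun y ↦ S.ι y (Y y) :=
  ContMDiff.clm_bundle_apply S.ι_contMDiff hY

theorem diffSecAt_ι (hY : DiffFieldAt Y x) : DiffSecAt (fun y ↦ S.ι y (Y y)) x :=
  MDifferentiableAt.clm_bundle_apply (S.ι_contMDiff.mdifferentiable (by simp) x) hY

theorem smoothSec_J (hσ : SmoothSec σ) : SmoothSec fun y ↦ S.J y (σ y) :=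
  ContMDiff.clm_bundle_apply S.J_contMDiff hσ

theorem diffSecAt_J (hσ : DiffSecAt σ x) : DiffSecAt (fun y ↦ S.J y (σ y)) x :=
  MDifferentiableAt.clm_bundle_apply (S.J_contMDiff.mdifferentiable (by simp) x) hσ

theorem mdifferentiableAt_metric (hσ : DiffSecAt σ x) (hτ : DiffSecAt τ x) :
    MDifferentiableAt (𝓡 2) 𝓘(ℝ, ℝ) (fun y ↦ S.metric y (σ y) (τ y)) x :=
  mdifferentiableAt_form_apply S.metric_contMDiff hσ hτ

theorem contMDiff_g (hX : SmoothField X) (hY : SmoothField Y) :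
    ContMDiff (𝓡 2) 𝓘(ℝ, ℝ) ∞ fun y ↦ S.g y (X y) (Y y) :=
  contMDiff_form_apply S.metric_contMDiff (S.smoothSec_ι hX) (S.smoothSec_ι hY)

theorem diffSecAt_conn (hσ : SmoothSec σ) (hX : SmoothField X) :
    DiffSecAt (fun y ↦ S.conn σ y (X y)) x :=
  mdifferentiableAt_covariantDerivative_apply S.conn_contMDiff hσ hX

-- The dual frame is given by the inverse of the Gram matrix of `A, B`.
theorem exists_diffFieldAt_dual_frame {A B : ∀ x : M, TangentSpace (𝓡 2) x}
    (hA : SmoothField A) (hB : SmoothField B)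
    (hgram : S.g x (A x) (A x) * S.g x (B x) (B x) - S.g x (A x) (B x) ^ 2 ≠ 0) :
    ∃ A' B' : ∀ x : M, TangentSpace (𝓡 2) x, DiffFieldAt A' x ∧ DiffFieldAt B' x ∧
      ∀ᶠ y in 𝓝 x, (S.g y (A y) (A' y) = 1 ∧ S.g y (B y) (A' y) = 0) ∧
        S.g y (A y) (B' y) = 0 ∧ S.g y (B y) (B' y) = 1 := by
  have diff {f : M → ℝ} (hf : ContMDiff (𝓡 2) 𝓘(ℝ, ℝ) ∞ f) :
      MDifferentiableAt (𝓡 2) 𝓘(ℝ, ℝ) f x := hf.mdifferentiable (by simp) x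
  set D : M → ℝ := fun y ↦ S.g y (A y) (A y) * S.g y (B y) (B y) - S.g y (A y) (B y) ^ 2 with hD
  have hDsmooth : ContMDiff (𝓡 2) 𝓘(ℝ, ℝ) ∞ D :=
    ((S.contMDiff_g hA hA).mul (S.contMDiff_g hB hB)).sub ((S.contMDiff_g hA hB).pow 2)
  have hDinv : MDifferentiableAt (𝓡 2) 𝓘(ℝ, ℝ) (fun y ↦ (D y)⁻¹) x :=
    (hDsmooth.contMDiffAt.inv₀ hgram).mdifferentiableAt (by simp)
  refine ⟨fun y ↦ (D y)⁻¹ • (S.g y (B y) (B y) • A y - S.g y (A y) (B y) • B y),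
    fun y ↦ (D y)⁻¹ • (S.g y (A y) (A y) • B y - S.g y (A y) (B y) • A y), ?_, ?_, ?_⟩
  · exact hDinv.smul_section (mdifferentiableAt_sub_section
      ((diff (S.contMDiff_g hB hB)).smul_section hA.diffFieldAt)
      ((diff (S.contMDiff_g hA hB)).smul_section hB.diffFieldAt))
  · exact hDinv.smul_section (mdifferentiableAt_sub_section
      ((diff (S.contMDiff_g hA hA)).smul_section hB.diffFieldAt)
      ((diff (S.contMDiff_g hA hB)).smul_section hA.diffFieldAt))
  · filter_upwards [hDsmooth.continuous.continuousAt.eventually_ne hgram] with y hy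
    simp only [map_smul, map_sub, smul_eq_mul, S.g_symm (B y) (A y), inv_mul_eq_div]
    refine ⟨⟨?_, ?_⟩, ?_, ?_⟩ <;> field_simp <;> simp only [hD] <;> ring

theorem diffFieldAt_tang [T2Space M] (hσ : DiffSecAt σ x) :
    DiffFieldAt (fun y ↦ S.tang y (σ y)) x := by
  obtain ⟨a, b, hab⟩ := S.exists_isNullPair x
  obtain ⟨A, hA, rfl⟩ := exists_smoothField_apply_eq a
  obtain ⟨B, hB, rfl⟩ := exists_smoothField_apply_eq b
  obtain ⟨A', B', hA', hB', hdual⟩ := S.exists_diffFieldAt_dual_frame (x := x) hA hB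
    (by simp [hab.null_fst, hab.pairing])
  have htang : ∀ᶠ y in 𝓝 x, S.tang y (σ y) =
      S.metric y (σ y) (S.ι y (A' y)) • A y + S.metric y (σ y) (S.ι y (B' y)) • B y := by
    filter_upwards [hdual] with y ⟨⟨hAA, hBA⟩, hAB, hBB⟩
    rw [← g_tang, ← g_tang]
    exact S.eq_combination_of_g_dual hAA hBA hAB hBB _
  refine (mdifferentiableAt_add_section
    ((S.mdifferentiableAt_metric hσ (S.diffSecAt_ι hA')).smul_section
      hA.diffFieldAt)
    ((S.mdifferentiableAt_metric hσ (S.diffSecAt_ι hB')).smul_section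
      hB.diffFieldAt)).congr_of_eventuallyEq ?_
  filter_upwards [htang] with y hy
  simp only [hy, Pi.add_apply, Pi.smul_apply']

theorem diffSecAt_nor [T2Space M] (hσ : DiffSecAt σ x) : DiffSecAt (fun y ↦ S.nor y (σ y)) x :=
  mdifferentiableAt_sub_section hσ (S.diffSecAt_ι (S.diffFieldAt_tang hσ))

end Regularity

section Connection

variable {x : M} {X Y Z W : ∀ x : M, TangentSpace (𝓡 2) x} {ξ η : ∀ x, E x}

theorem ι_nabla_add_h : S.ι x (S.nabla Y x (X x)) + S.h X Y x =
    S.conn (fun y ↦ S.ι y (Y y)) x (X x) :=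
  S.ι_tang_add_nor _

theorem metric_h_ι (u : TangentSpace (𝓡 2) x) : S.metric x (S.h X Y x) (S.ι x u) = 0 :=
  S.metric_nor_ι x _ u

theorem nabla_sub_nabla (hX : DiffFieldAt X x) (hY : DiffFieldAt Y x) :
    S.nabla Y x (X x) - S.nabla X x (Y x) = VectorField.mlieBracket (𝓡 2) X Y x := by
  rw [nabla, nabla, ← tang_sub, S.torsion_free x X Y hX hY, tang_ι]

theorem h_symm (hX : DiffFieldAt X x) (hY : DiffFieldAt Y x) : S.h X Y x = S.h Y X x := by
  rw [← sub_eq_zero, h, h, ← nor_sub, S.torsion_free x X Y hX hY, nor_ι]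

theorem h_combination {A B : ∀ x : M, TangentSpace (𝓡 2) x}
    (hA : DiffFieldAt A x) (hB : DiffFieldAt B x) (hY : DiffFieldAt Y x)
    {p q r t : ℝ} (hXx : X x = p • A x + q • B x) (hYx : Y x = r • A x + t • B x) :
    S.h X Y x = (p * r) • S.h A A x + (p * t + q * r) • S.h A B x + (q * t) • S.h B B x := by
  have left {V Z : ∀ x : M, TangentSpace (𝓡 2) x} {p q : ℝ} (hV : V x = p • A x + q • B x) :
      S.h V Z x = p • S.h A Z x + q • S.h B Z x := by
    simp only [h, hV, map_add, map_smul, nor_add, nor_smul]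
  rw [left hXx, S.h_symm hA hY, S.h_symm hB hY, left hYx, left hYx, S.h_symm hB hA]
  module

theorem metric_conn_of_normal (hξn : S.IsNormal ξ) (hξ : DiffSecAt ξ x) (hW : DiffFieldAt W x)
    (u : TangentSpace (𝓡 2) x) : S.metric x (S.conn ξ x u) (S.ι x (W x)) =
      -S.metric x (ξ x) (S.conn (fun y ↦ S.ι y (W y)) x u) := by
  have hderiv := S.conn_metric x ξ _ hξ (S.diffSecAt_ι hW) u
  have horth : (fun y ↦ S.metric y (ξ y) (S.ι y (W y))) = fun _ ↦ 0 := funext fun y ↦ hξn y _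
  rw [horth, mvfderiv_const, zero_apply] at hderiv
  linarith

theorem metric_conn_eq_neg_metric_h (hξn : S.IsNormal ξ) (hξ : DiffSecAt ξ x)
    (hW : DiffFieldAt W x) :
    S.metric x (S.conn ξ x (X x)) (S.ι x (W x)) = -S.metric x (S.h X W x) (ξ x) := by
  rw [S.metric_conn_of_normal hξn hξ hW, h, S.metric_nor_left_of_normal (hξn x), S.metric_symm]

theorem g_shape (hξn : S.IsNormal ξ) (hξ : DiffSecAt ξ x) (hW : DiffFieldAt W x) :
    S.g x (S.shape ξ X x) (W x) = S.metric x (S.h X W x) (ξ x) := by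
  rw [shape, map_neg, LinearMap.neg_apply, g_tang, S.metric_conn_eq_neg_metric_h hξn hξ hW,
    neg_neg]

theorem g_shape_symm (hξn : S.IsNormal ξ) (hξ : DiffSecAt ξ x) (hX : DiffFieldAt X x)
    (hW : DiffFieldAt W x) : S.g x (S.shape ξ X x) (W x) = S.g x (S.shape ξ W x) (X x) := by
  rw [S.g_shape hξn hξ hW, S.g_shape hξn hξ hX, S.h_symm hX hW]

theorem metric_normalConn (hηn : S.IsNormal η) (u : TangentSpace (𝓡 2) x) :
    S.metric x (S.normalConn ξ x u) (η x) = S.metric x (S.conn ξ x u) (η x) :=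
  S.metric_nor_left_of_normal (hηn x)

end Connection

section Curvature

variable {x : M} {X Y Z W : ∀ x : M, TangentSpace (𝓡 2) x} {σ τ ξ η : ∀ x, E x}

theorem metric_covariantCurvature_left (hX : SmoothField X) (hY : SmoothField Y)
    (hσ : SmoothSec σ) (hτ : SmoothSec τ) :
    S.metric x (covariantCurvature S.conn X Y σ x) (τ x) =
      -S.metric x (σ x) (covariantCurvature S.conn X Y τ x) :=
  covariantCurvature_skew_of_parallel_form S.conn_contMDiff S.metric_contMDiff S.conn_metric
    hX hY hσ hτ

variable [T2Space M]

theorem covariantCurvature_congr (hX : SmoothField X) (hY : SmoothField Y)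
    (hσ : SmoothSec σ) (hτ : SmoothSec τ) (h : σ x = τ x) :
    covariantCurvature S.conn X Y σ x = covariantCurvature S.conn X Y τ x := by
  refine S.eq_of_metric_eq fun v ↦ ?_
  obtain ⟨ρ, hρ, rfl⟩ := exists_contMDiff_section_apply_eq (I := 𝓡 2) (F := R4) v
  rw [S.metric_covariantCurvature_left hX hY hσ hρ, S.metric_covariantCurvature_left hX hY hτ hρ,
    h]

theorem diffFieldAt_nabla (hY : SmoothField Y) (hZ : SmoothField Z) :
    DiffFieldAt (fun y ↦ S.nabla Z y (Y y)) x :=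
  S.diffFieldAt_tang (S.diffSecAt_conn (S.smoothSec_ι hZ) hY)

theorem diffSecAt_h (hY : SmoothField Y) (hZ : SmoothField Z) : DiffSecAt (S.h Y Z) x :=
  S.diffSecAt_nor (S.diffSecAt_conn (S.smoothSec_ι hZ) hY)

theorem diffFieldAt_shape (hξ : SmoothSec ξ) (hX : SmoothField X) :
    DiffFieldAt (S.shape ξ X) x :=
  mdifferentiableAt_neg_section (S.diffFieldAt_tang (S.diffSecAt_conn hξ hX))

theorem conn_conn_ι (hY : SmoothField Y) (hZ : SmoothField Z) (u : TangentSpace (𝓡 2) x) :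
    S.conn (fun y ↦ S.conn (fun y ↦ S.ι y (Z y)) y (Y y)) x u =
      S.conn (fun y ↦ S.ι y (S.nabla Z y (Y y))) x u + S.conn (S.h Y Z) x u := by
  rw [← covariantDerivative_add_apply (S.diffSecAt_ι (S.diffFieldAt_nabla hY hZ))
    (S.diffSecAt_h hY hZ)]
  simp only [ι_nabla_add_h]

theorem metric_conn_conn_normal (hY : SmoothField Y) (hξ : SmoothSec ξ) (hη : SmoothSec η)
    (hηn : S.IsNormal η) :
    S.metric x (S.conn (fun y ↦ S.conn ξ y (Y y)) x (X x)) (η x) =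
      S.metric x (S.normalConn (fun y ↦ S.normalConn ξ y (Y y)) x (X x)) (η x)
        - S.g x (S.shape η X x) (S.shape ξ Y x) := by
  have weingarten : (fun y ↦ S.conn ξ y (Y y)) =
      fun y ↦ S.normalConn ξ y (Y y) - S.ι y (S.shape ξ Y y) := funext fun y ↦ by
    simp [normalConn, nor, shape]
  rw [S.g_shape hηn hη.diffSecAt (S.diffFieldAt_shape hξ hY), h,
    S.metric_nor_left_of_normal (hηn x), S.metric_normalConn hηn, weingarten,
    covariantDerivative_sub_apply (σ := fun y ↦ S.normalConn ξ y (Y y))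
      (S.diffSecAt_nor (S.diffSecAt_conn hξ hY)) (S.diffSecAt_ι (S.diffFieldAt_shape hξ hY)),
    map_sub, sub_apply]

theorem g_R (hX : SmoothField X) (hY : SmoothField Y) (hZ : SmoothField Z)
    (hW : SmoothField W) :
    S.g x (S.R X Y Z x) (W x) =
      S.metric x (covariantCurvature S.conn X Y (fun y ↦ S.ι y (Z y)) x) (S.ι x (W x))
        + S.metric x (S.h X W x) (S.h Y Z x) - S.metric x (S.h X Z x) (S.h Y W x) := by
  have hYZ := S.metric_conn_eq_neg_metric_h (X := X) (fun y u ↦ S.metric_h_ι (X := Y) (Y := Z) u)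
    (S.diffSecAt_h hY hZ) (hW.diffFieldAt (x := x))
  have hXZ := S.metric_conn_eq_neg_metric_h (X := Y) (fun y u ↦ S.metric_h_ι (X := X) (Y := Z) u)
    (S.diffSecAt_h hX hZ) (hW.diffFieldAt (x := x))
  rw [S.metric_symm x (S.h Y W x)] at hXZ
  rw [covariantCurvature, S.conn_conn_ι hY hZ, S.conn_conn_ι hX hZ, R]
  simp only [map_sub, map_add, LinearMap.sub_apply, sub_apply, add_apply, hYZ, hXZ, nabla, g_tang]
  ring

theorem nor_covariantCurvature_ι (hX : SmoothField X) (hY : SmoothField Y)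
    (hZ : SmoothField Z) :
    S.nor x (covariantCurvature S.conn X Y (fun y ↦ S.ι y (Z y)) x) =
      S.nablaBarH X Y Z x - S.nablaBarH Y X Z x := by
  rw [covariantCurvature, S.conn_conn_ι hY hZ, S.conn_conn_ι hX hZ,
    ← S.nabla_sub_nabla hX.diffFieldAt hY.diffFieldAt]
  simp only [map_sub, nor_sub, nor_add, nablaBarH, normalConn, h]
  abel

theorem metric_RD (hX : SmoothField X) (hY : SmoothField Y) (hξ : SmoothSec ξ)
    (hη : SmoothSec η) (hξn : S.IsNormal ξ) (hηn : S.IsNormal η) :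
    S.metric x (S.RD X Y ξ x) (η x) = S.metric x (covariantCurvature S.conn X Y ξ x) (η x)
      + S.g x (S.shape ξ (S.shape η X) x - S.shape η (S.shape ξ X) x) (Y x) := by
  rw [covariantCurvature, RD]
  simp only [map_sub, sub_apply, LinearMap.sub_apply, S.metric_conn_conn_normal hY hξ hη hηn,
    S.metric_conn_conn_normal hX hξ hη hηn, S.metric_normalConn (ξ := ξ) hηn]
  rw [S.g_shape_symm hξn hξ.diffSecAt (S.diffFieldAt_shape hη hX) hY.diffFieldAt,
    S.g_shape_symm hηn hη.diffSecAt (S.diffFieldAt_shape hξ hX) hY.diffFieldAt,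
    S.g_symm (S.shape ξ Y x)]
  ring

theorem covariantCurvature_ι_eq_Rtilde {c : ℝ} (hG : S.GaussAt c x) (hC : S.CodazziAt c x)
    (hX : SmoothField X) (hY : SmoothField Y) (hZ : SmoothField Z) :
    covariantCurvature S.conn X Y (fun y ↦ S.ι y (Z y)) x =
      S.Rtilde c x (S.ι x (X x)) (S.ι x (Y x)) (S.ι x (Z x)) := by
  have tangential : S.tang x (covariantCurvature S.conn X Y (fun y ↦ S.ι y (Z y)) x) =
      S.tang x (S.Rtilde c x (S.ι x (X x)) (S.ι x (Y x)) (S.ι x (Z x))) := by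
    refine S.eq_of_g_eq fun w ↦ ?_
    obtain ⟨W, hW, rfl⟩ := exists_smoothField_apply_eq w
    have hGauss := hG X Y Z W hX hY hZ hW
    rw [S.g_R hX hY hZ hW] at hGauss
    rw [g_tang, g_tang]
    linarith
  rw [← S.ι_tang_add_nor (covariantCurvature _ _ _ _ _), tangential,
    S.nor_covariantCurvature_ι hX hY hZ, ← hC X Y Z hX hY hZ, ι_tang_add_nor]

theorem ricciAt_of_gaussAt_of_codazziAt {c : ℝ} (hG : S.GaussAt c x) (hC : S.CodazziAt c x) :
    S.RicciAt c x := by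
  intro X Y ξ η hX hY hξ hη hξn hηn
  obtain ⟨u, v, huv⟩ := S.exists_eq_J_ι_sub_ι (hξn x)
  obtain ⟨A, hA, rfl⟩ := exists_smoothField_apply_eq u
  obtain ⟨B, hB, rfl⟩ := exists_smoothField_apply_eq v
  have hJA := S.smoothSec_J (S.smoothSec_ι hA)
  have hcurv : covariantCurvature S.conn X Y ξ x =
      S.Rtilde c x (S.ι x (X x)) (S.ι x (Y x)) (ξ x) := by
    rw [S.covariantCurvature_congr (τ := fun y ↦ S.J y (S.ι y (A y)) - S.ι y (B y)) hX hY hξ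
        (ContMDiff.sub_section hJA (S.smoothSec_ι hB)) huv,
      covariantCurvature_sub S.conn_contMDiff hX hY hJA (S.smoothSec_ι hB),
      covariantCurvature_parallel_endomorphism S.conn_contMDiff S.conn_J hX hY (S.smoothSec_ι hA),
      S.covariantCurvature_ι_eq_Rtilde hG hC hX hY hA,
      S.covariantCurvature_ι_eq_Rtilde hG hC hX hY hB, huv, Rtilde_sub, Rtilde_J]
  rw [S.metric_RD hX hY hξ hη hξn hηn, hcurv]

theorem g_R_left (hX : SmoothField X) (hY : SmoothField Y) (hZ : SmoothField Z)
    (hW : SmoothField W) : S.g x (S.R X Y Z x) (W x) = -S.g x (Z x) (S.R X Y W x) := by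
  have hskew := S.metric_covariantCurvature_left (x := x) hX hY (S.smoothSec_ι hZ)
    (S.smoothSec_ι hW)
  rw [S.g_symm (Z x), S.g_R hX hY hZ hW, S.g_R hX hY hW hZ, hskew,
    S.metric_symm x (S.h X Z x), S.metric_symm x (S.h X W x), S.metric_symm x (S.ι x (Z x))]
  ring

end Curvature

section Germs

variable {x : M} {X Y Z X' Y' Z' : ∀ x : M, TangentSpace (𝓡 2) x}

theorem dirDeriv_metric {σ τ : ∀ x, E x} (hσ : DiffSecAt σ x) (hτ : DiffSecAt τ x) :
    dirDeriv X (fun y ↦ S.metric y (σ y) (τ y)) x =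
      S.metric x (S.conn σ x (X x)) (τ x) + S.metric x (σ x) (S.conn τ x (X x)) :=
  S.conn_metric x σ τ hσ hτ (X x)

theorem conn_eq_zero_of_eventually {σ : ∀ x, E x} (h : ∀ᶠ y in 𝓝 x, σ y = 0) :
    S.conn σ x = 0 := by
  rw [← covariantDerivative_congr_of_eventuallyEq (σ := 0) (mdifferentiableAt_zeroSection ..)
    (h.mono fun y hy ↦ hy.symm)]
  simp

theorem nabla_eq_zero_of_eventually (h : ∀ᶠ y in 𝓝 x, Y y = 0) (u : TangentSpace (𝓡 2) x) :
    S.nabla Y x u = 0 := by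
  rw [nabla, S.conn_eq_zero_of_eventually (h.mono fun y hy ↦ by rw [hy, map_zero]),
    zero_apply, tang_zero]

theorem conn_ι_eventuallyEq (hY : SmoothField Y) (hYY' : ∀ᶠ y in 𝓝 x, Y y = Y' y) :
    ∀ᶠ y in 𝓝 x, S.conn (fun z ↦ S.ι z (Y z)) y = S.conn (fun z ↦ S.ι z (Y' z)) y := by
  filter_upwards [hYY'.eventually_nhds] with y hy
  exact covariantDerivative_congr_of_eventuallyEq (S.smoothSec_ι hY).diffSecAt
    (hy.mono fun z hz ↦ by rw [hz])

theorem nabla_eventuallyEq (hY : SmoothField Y) (hYY' : ∀ᶠ y in 𝓝 x, Y y = Y' y) :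
    ∀ᶠ y in 𝓝 x, ∀ u, S.nabla Y y u = S.nabla Y' y u := by
  filter_upwards [S.conn_ι_eventuallyEq hY hYY'] with y hy u
  rw [nabla, nabla, hy]

theorem h_eventuallyEq (hY : SmoothField Y) (hXX' : ∀ᶠ y in 𝓝 x, X y = X' y)
    (hYY' : ∀ᶠ y in 𝓝 x, Y y = Y' y) : ∀ᶠ y in 𝓝 x, S.h X Y y = S.h X' Y' y := by
  filter_upwards [S.conn_ι_eventuallyEq hY hYY', hXX'] with y hy hXy
  rw [h, h, hy, hXy]

theorem nablaBarH_of_parallel (hY : ∀ u, S.nabla Y x u = 0)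
    (hZ : ∀ᶠ y in 𝓝 x, ∀ u, S.nabla Z y u = 0) :
    S.nablaBarH X Y Z x = S.normalConn (S.h Y Z) x (X x) := by
  have hfst : S.h (fun y ↦ S.nabla Y y (X y)) Z x = 0 := by rw [h, hY, map_zero, nor_zero]
  have hsnd : S.h Y (fun y ↦ S.nabla Z y (X y)) x = 0 := by
    rw [h, S.conn_eq_zero_of_eventually (hZ.mono fun y hy ↦ by rw [hy, map_zero]),
      zero_apply, nor_zero]
  rw [nablaBarH, hfst, hsnd, sub_zero, sub_zero]

theorem R_eq_zero_of_parallel (hZ : ∀ᶠ y in 𝓝 x, ∀ u, S.nabla Z y u = 0) :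
    S.R X Y Z x = 0 := by
  have hnabla (V : ∀ x : M, TangentSpace (𝓡 2) x) : ∀ᶠ y in 𝓝 x, S.nabla Z y (V y) = 0 :=
    hZ.mono fun y hy ↦ hy (V y)
  rw [R, S.nabla_eq_zero_of_eventually (hnabla Y), S.nabla_eq_zero_of_eventually (hnabla X),
    hZ.self_of_nhds, sub_zero, sub_zero]

variable [T2Space M]

theorem nablaBarH_congr (hX : SmoothField X) (hY : SmoothField Y) (hZ : SmoothField Z)
    (hXX' : ∀ᶠ y in 𝓝 x, X y = X' y) (hYY' : ∀ᶠ y in 𝓝 x, Y y = Y' y)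
    (hZZ' : ∀ᶠ y in 𝓝 x, Z y = Z' y) : S.nablaBarH X Y Z x = S.nablaBarH X' Y' Z' x := by
  have hD : S.conn (S.h Y Z) x = S.conn (S.h Y' Z') x :=
    covariantDerivative_congr_of_eventuallyEq (S.diffSecAt_h hY hZ) (S.h_eventuallyEq hZ hYY' hZZ')
  have hnablaZ : S.conn (fun y ↦ S.ι y (S.nabla Z y (X y))) x =
      S.conn (fun y ↦ S.ι y (S.nabla Z' y (X' y))) x := by
    refine covariantDerivative_congr_of_eventuallyEq
      (S.diffSecAt_ι (S.diffFieldAt_nabla hX hZ)) ?_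
    filter_upwards [S.nabla_eventuallyEq hZ hZZ', hXX'] with y hy hXy
    rw [hy, hXy]
  simp only [nablaBarH, normalConn, h, hD, hnablaZ, hXX'.self_of_nhds, hYY'.self_of_nhds,
    (S.nabla_eventuallyEq hY hYY').self_of_nhds, (S.conn_ι_eventuallyEq hZ hZZ').self_of_nhds]

theorem diffSecAt_h_of_smoothFieldOn {U : Set M} (hU : U ∈ 𝓝 x) (hX : SmoothFieldOn X U)
    (hY : SmoothFieldOn Y U) : DiffSecAt (S.h X Y) x := by
  obtain ⟨A, hA, hAX⟩ := hX.exists_smoothField_eventuallyEq hU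
  obtain ⟨B, hB, hBY⟩ := hY.exists_smoothField_eventuallyEq hU
  refine (S.diffSecAt_h hA hB).congr_of_eventuallyEq ?_
  filter_upwards [S.h_eventuallyEq hB hAX hBY] with y hy
  rw [hy]

variable {S} in
theorem CodazziAt.nor_Rtilde_of_smoothFieldOn {c : ℝ} (hC : S.CodazziAt c x) {U : Set M}
    (hU : U ∈ 𝓝 x) (hX : SmoothFieldOn X U) (hY : SmoothFieldOn Y U) (hZ : SmoothFieldOn Z U) :
    S.nor x (S.Rtilde c x (S.ι x (X x)) (S.ι x (Y x)) (S.ι x (Z x))) =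
      S.nablaBarH X Y Z x - S.nablaBarH Y X Z x := by
  obtain ⟨A, hA, hAX⟩ := hX.exists_smoothField_eventuallyEq hU
  obtain ⟨B, hB, hBY⟩ := hY.exists_smoothField_eventuallyEq hU
  obtain ⟨C, hC', hCZ⟩ := hZ.exists_smoothField_eventuallyEq hU
  have hABC := hC A B C hA hB hC'
  rwa [hAX.self_of_nhds, hBY.self_of_nhds, hCZ.self_of_nhds,
    S.nablaBarH_congr hA hB hC' hAX hBY hCZ, S.nablaBarH_congr hB hA hC' hBY hAX hCZ] at hABC

theorem g_R_parallel {e : ∀ x : M, TangentSpace (𝓡 2) x} {U : Set M} (hU : U ∈ 𝓝 x)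
    (he : SmoothFieldOn e U) (hpar : ∀ y ∈ U, ∀ u, S.nabla e y u = 0)
    (hX : SmoothField X) (hY : SmoothField Y) (hZ : SmoothField Z) :
    S.g x (S.R X Y Z x) (e x) = 0 := by
  obtain ⟨A, hA, hAe⟩ := he.exists_smoothField_eventuallyEq hU
  have hApar : ∀ᶠ y in 𝓝 x, ∀ u, S.nabla A y u = 0 := by
    filter_upwards [S.nabla_eventuallyEq hA hAe, hU] with y hy hyU u
    rw [hy, hpar y hyU]
  rw [← hAe.self_of_nhds, S.g_R_left hX hY hZ hA, S.R_eq_zero_of_parallel hApar, map_zero,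
    neg_zero]

end Germs

section MeanCurvature

variable {x : M}

theorem sum_g_mul_g_dualBasis (b : Module.Basis (Fin 2) ℝ (TangentSpace (𝓡 2) x))
    (u v : TangentSpace (𝓡 2) x) :
    ∑ i, S.g x (b i) u * S.g x ((S.g x).dualBasis (S.g_nondegenerate x) b i) v = S.g x u v := by
  conv_rhs => rw [← ((S.g x).dualBasis (S.g_nondegenerate x) b).sum_repr u]
  simp [LinearMap.BilinForm.dualBasis_repr_apply, S.g_symm u]

variable {S} in
theorem IsNullPair.meanCurvature_eq {A B : ∀ x : M, TangentSpace (𝓡 2) x}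
    (hab : S.IsNullPair (A x) (B x)) (hA : DiffFieldAt A x) (hB : DiffFieldAt B x) :
    S.meanCurvature x = -S.h A B x := by
  let b : Module.Basis (Fin 2) ℝ (TangentSpace (𝓡 2) x) :=
    (EuclideanSpace.basisFun (Fin 2) ℝ).toBasis
  let b' := (S.g x).dualBasis (S.g_nondegenerate x) b
  have hterm (i) : S.h (FiberBundle.extend (EuclideanSpace ℝ (Fin 2)) (b i))
      (FiberBundle.extend (EuclideanSpace ℝ (Fin 2)) (b' i)) x =
      (S.g x (b i) (B x) * S.g x (b' i) (B x)) • S.h A A x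
      + (S.g x (b i) (B x) * S.g x (b' i) (A x) + S.g x (b i) (A x) * S.g x (b' i) (B x)) •
        S.h A B x
      + (S.g x (b i) (A x) * S.g x (b' i) (A x)) • S.h B B x := by
    rw [S.h_combination hA hB (FiberBundle.mdifferentiableAt_extend ..)
      (by rw [FiberBundle.extend_apply_self]; exact hab.eq_combination (b i))
      (by rw [FiberBundle.extend_apply_self]; exact hab.eq_combination (b' i))]
    simp only [neg_mul_neg]
  change (1 / 2 : ℝ) • ∑ i, S.h (FiberBundle.extend (EuclideanSpace ℝ (Fin 2)) (b i))
    (FiberBundle.extend (EuclideanSpace ℝ (Fin 2)) (b' i)) x = _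
  simp only [hterm, Finset.sum_add_distrib, ← Finset.sum_smul, b', S.sum_g_mul_g_dualBasis,
    hab.null_fst, hab.null_snd, hab.pairing, hab.pairing_swap]
  module

end MeanCurvature

/-- The coefficients `γ` (for `e = e₁`) and `λ` (for `e = e₂`) of `h(e, e)` in the adapted frame
with Wirtinger angle `α`, written as `-(sech α)⟨h(e, e), Je⟩`. -/
noncomputable def cubicCoeff (α : M → ℝ) (e : ∀ x : M, TangentSpace (𝓡 2) x) (x : M) : ℝ :=
  -(S.metric x (S.h e e x) (S.J x (S.ι x (e x))) / Real.cosh (α x))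

theorem sinh_wirtingerAngle (e₁ e₂ : ∀ x : M, TangentSpace (𝓡 2) x) (x : M) :
    Real.sinh (S.wirtingerAngle e₁ e₂ x) = S.sinhAngle (e₁ x) (e₂ x) :=
  Real.sinh_arsinh _

theorem one_add_sinhAngle_sq (e₁ e₂ : ∀ x : M, TangentSpace (𝓡 2) x) (x : M) :
    1 + S.sinhAngle (e₁ x) (e₂ x) ^ 2 = Real.cosh (S.wirtingerAngle e₁ e₂ x) ^ 2 := by
  rw [Real.cosh_sq', sinh_wirtingerAngle]

namespace IsParallelNullFrame

variable {S} {U : Set M} {e₁ e₂ : ∀ x : M, TangentSpace (𝓡 2) x}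
  (he : S.IsParallelNullFrame U e₁ e₂) {x : M}
include he

local notation "α" => wirtingerAngle S e₁ e₂

theorem isNullPair (hx : x ∈ U) : S.IsNullPair (e₁ x) (e₂ x) :=
  ⟨he.null_fst x hx, he.null_snd x hx, he.pairing x hx⟩

theorem diffFieldAt_fst (hx : x ∈ U) : DiffFieldAt e₁ x :=
  he.contMDiffOn_fst.diffFieldAt (he.isOpen.mem_nhds hx)

theorem diffFieldAt_snd (hx : x ∈ U) : DiffFieldAt e₂ x :=
  he.contMDiffOn_snd.diffFieldAt (he.isOpen.mem_nhds hx)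

theorem P_fst (hx : x ∈ U) : S.P x (e₁ x) = Real.sinh (α x) • e₁ x := by
  rw [sinh_wirtingerAngle, (he.isNullPair hx).P_fst]

theorem P_snd (hx : x ∈ U) : S.P x (e₂ x) = -(Real.sinh (α x) • e₂ x) := by
  rw [sinh_wirtingerAngle, (he.isNullPair hx).P_snd]

theorem contMDiffOn_wirtingerAngle : ContMDiffOn (𝓡 2) 𝓘(ℝ, ℝ) ∞ α U := by
  have hsmooth := (contMDiffOn_form_apply S.metric_contMDiff
    (ContMDiffOn.clm_bundle_apply S.J_contMDiff.contMDiffOn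
      (ContMDiffOn.clm_bundle_apply S.ι_contMDiff.contMDiffOn he.contMDiffOn_fst))
    (ContMDiffOn.clm_bundle_apply S.ι_contMDiff.contMDiffOn he.contMDiffOn_snd)).neg
  refine (Real.contDiff_arsinh.contMDiff.comp_contMDiffOn hsmooth).congr fun y _ ↦ ?_
  rw [wirtingerAngle, P, g_tang, Function.comp_apply]

theorem mdifferentiableAt_wirtingerAngle (hx : x ∈ U) : MDifferentiableAt (𝓡 2) 𝓘(ℝ, ℝ) α x :=
  (he.contMDiffOn_wirtingerAngle.contMDiffAt (he.isOpen.mem_nhds hx)).mdifferentiableAt (by simp)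

theorem conn_fst (hx : x ∈ U) (X : ∀ x : M, TangentSpace (𝓡 2) x) :
    S.conn (fun y ↦ S.ι y (e₁ y)) x (X x) = S.h X e₁ x := by
  rw [← ι_nabla_add_h, he.parallel_fst x hx, map_zero, zero_add]

theorem conn_snd (hx : x ∈ U) (X : ∀ x : M, TangentSpace (𝓡 2) x) :
    S.conn (fun y ↦ S.ι y (e₂ y)) x (X x) = S.h X e₂ x := by
  rw [← ι_nabla_add_h, he.parallel_snd x hx, map_zero, zero_add]

theorem cosh_mul_dirDeriv (hx : x ∈ U) (X : ∀ x : M, TangentSpace (𝓡 2) x) :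
    Real.cosh (α x) * dirDeriv X α x = S.metric x (S.h X e₁ x) (S.J x (S.ι x (e₂ x)))
      - S.metric x (S.h X e₂ x) (S.J x (S.ι x (e₁ x))) := by
  have d₁ := S.diffSecAt_ι (he.diffFieldAt_fst hx)
  have d₂ := S.diffSecAt_ι (he.diffFieldAt_snd hx)
  have hsinh : (fun y ↦ Real.sinh (α y)) =
      fun y ↦ -S.metric y (S.J y (S.ι y (e₁ y))) (S.ι y (e₂ y)) := funext fun y ↦ by
    rw [sinh_wirtingerAngle, sinhAngle, P, g_tang]
  rw [← dirDeriv_comp (Real.hasDerivAt_sinh _) (he.mdifferentiableAt_wirtingerAngle hx), hsinh,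
    dirDeriv_neg, S.dirDeriv_metric (S.diffSecAt_J d₁) d₂, S.conn_J x _ d₁, he.conn_fst hx,
    he.conn_snd hx, metric_J_left, S.metric_symm x _ (S.h X e₂ x)]
  ring

theorem metric_combination_adaptedNormal (hx : x ∈ U) (p q r t : ℝ) :
    S.metric x (p • S.adaptedNormal α e₁ x + q • S.adaptedNormal α e₂ x)
      (r • S.adaptedNormal α e₁ x + t • S.adaptedNormal α e₂ x) = -(p * t + q * r) := by
  have hcosh := (Real.cosh_pos (α x)).ne'
  simp only [adaptedNormal, smul_smul]
  rw [(he.isNullPair hx).metric_combination_F, one_add_sinhAngle_sq]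
  field_simp

theorem metric_combination_adaptedNormal_J (hx : x ∈ U) (p q r t : ℝ) :
    S.metric x (p • S.adaptedNormal α e₁ x + q • S.adaptedNormal α e₂ x)
      (S.J x (r • S.adaptedNormal α e₁ x + t • S.adaptedNormal α e₂ x)) =
      Real.sinh (α x) * (q * r - p * t) := by
  have hcosh := (Real.cosh_pos (α x)).ne'
  simp only [adaptedNormal, smul_smul]
  rw [(he.isNullPair hx).metric_combination_F_J, one_add_sinhAngle_sq, ← sinh_wirtingerAngle]
  field_simp

theorem eq_combination_adaptedNormal (hx : x ∈ U) {w : E x}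
    (hw : ∀ u, S.metric x w (S.ι x u) = 0) :
    w = (-(S.metric x w (S.J x (S.ι x (e₂ x))) / Real.cosh (α x))) • S.adaptedNormal α e₁ x +
      (-(S.metric x w (S.J x (S.ι x (e₁ x))) / Real.cosh (α x))) • S.adaptedNormal α e₂ x := by
  conv_lhs => rw [(he.isNullPair hx).eq_combination_F hw, one_add_sinhAngle_sq]
  rw [adaptedNormal, adaptedNormal, smul_smul, smul_smul]
  congr 2 <;> field_simp

theorem R_eq_zero [T2Space M] (hx : x ∈ U) {X Y Z : ∀ x : M, TangentSpace (𝓡 2) x}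
    (hX : SmoothField X) (hY : SmoothField Y) (hZ : SmoothField Z) : S.R X Y Z x = 0 := by
  have hU := he.isOpen.mem_nhds hx
  rw [(he.isNullPair hx).eq_combination (S.R X Y Z x),
    S.g_R_parallel hU he.contMDiffOn_fst he.parallel_fst hX hY hZ,
    S.g_R_parallel hU he.contMDiffOn_snd he.parallel_snd hX hY hZ]
  simp

section Minimal

variable (hmin : ∀ x ∈ U, S.meanCurvature x = 0)
include hmin

theorem h_fst_snd (hx : x ∈ U) : S.h e₁ e₂ x = 0 := by
  rw [← neg_eq_zero, ← (he.isNullPair hx).meanCurvature_eq (he.diffFieldAt_fst hx)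
    (he.diffFieldAt_snd hx), hmin x hx]

theorem h_snd_fst (hx : x ∈ U) : S.h e₂ e₁ x = 0 := by
  rw [S.h_symm (he.diffFieldAt_snd hx) (he.diffFieldAt_fst hx), he.h_fst_snd hmin hx]

theorem cosh_mul_dirDeriv_fst (hx : x ∈ U) : Real.cosh (α x) * dirDeriv e₁ α x =
    S.metric x (S.h e₁ e₁ x) (S.J x (S.ι x (e₂ x))) := by
  rw [he.cosh_mul_dirDeriv hx, he.h_fst_snd hmin hx, map_zero, zero_apply, sub_zero]

theorem cosh_mul_dirDeriv_snd (hx : x ∈ U) : Real.cosh (α x) * dirDeriv e₂ α x =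
    -S.metric x (S.h e₂ e₂ x) (S.J x (S.ι x (e₁ x))) := by
  rw [he.cosh_mul_dirDeriv hx, he.h_snd_fst hmin hx, map_zero, zero_apply, zero_sub]

theorem h_fst_fst (hx : x ∈ U) : S.h e₁ e₁ x =
    (-dirDeriv e₁ α x) • S.adaptedNormal α e₁ x +
      S.cubicCoeff α e₁ x • S.adaptedNormal α e₂ x := by
  have hcosh := (Real.cosh_pos (α x)).ne'
  conv_lhs => rw [he.eq_combination_adaptedNormal hx fun u ↦ S.metric_h_ι u]
  rw [← he.cosh_mul_dirDeriv_fst hmin hx, mul_div_cancel_left₀ _ hcosh, cubicCoeff]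

theorem h_snd_snd (hx : x ∈ U) : S.h e₂ e₂ x =
    S.cubicCoeff α e₂ x • S.adaptedNormal α e₁ x +
      dirDeriv e₂ α x • S.adaptedNormal α e₂ x := by
  have hcosh := (Real.cosh_pos (α x)).ne'
  conv_lhs => rw [he.eq_combination_adaptedNormal hx fun u ↦ S.metric_h_ι u]
  rw [← neg_div, ← neg_div, ← he.cosh_mul_dirDeriv_snd hmin hx, mul_div_cancel_left₀ _ hcosh,
    neg_div, cubicCoeff]

theorem metric_h_fst_fst_h_snd_snd (hx : x ∈ U) : S.metric x (S.h e₁ e₁ x) (S.h e₂ e₂ x) =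
    dirDeriv e₁ α x * dirDeriv e₂ α x - S.cubicCoeff α e₁ x * S.cubicCoeff α e₂ x := by
  rw [he.h_fst_fst hmin hx, he.h_snd_snd hmin hx, he.metric_combination_adaptedNormal hx]
  ring

theorem metric_h_fst_fst_J_h_snd_snd (hx : x ∈ U) :
    S.metric x (S.h e₁ e₁ x) (S.J x (S.h e₂ e₂ x)) = Real.sinh (α x) *
      (dirDeriv e₁ α x * dirDeriv e₂ α x + S.cubicCoeff α e₁ x * S.cubicCoeff α e₂ x) := by
  rw [he.h_fst_fst hmin hx, he.h_snd_snd hmin hx, he.metric_combination_adaptedNormal_J hx]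
  ring

theorem h_eq_combination (hx : x ∈ U) {X Y : ∀ x : M, TangentSpace (𝓡 2) x} {p q r t : ℝ}
    (hY : DiffFieldAt Y x) (hXx : X x = p • e₁ x + q • e₂ x) (hYx : Y x = r • e₁ x + t • e₂ x) :
    S.h X Y x = (p * r) • S.h e₁ e₁ x + (q * t) • S.h e₂ e₂ x := by
  rw [S.h_combination (he.diffFieldAt_fst hx) (he.diffFieldAt_snd hx) hY hXx hYx,
    he.h_fst_snd hmin hx, smul_zero, add_zero]

theorem gauss_rhs_eq (hx : x ∈ U) {X Y Z W : ∀ x : M, TangentSpace (𝓡 2) x}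
    {p₁ q₁ p₂ q₂ p₃ q₃ p₄ q₄ : ℝ} (hZ : DiffFieldAt Z x) (hW : DiffFieldAt W x)
    (hXx : X x = p₁ • e₁ x + q₁ • e₂ x) (hYx : Y x = p₂ • e₁ x + q₂ • e₂ x)
    (hZx : Z x = p₃ • e₁ x + q₃ • e₂ x) (hWx : W x = p₄ • e₁ x + q₄ • e₂ x) (c : ℝ) :
    S.metric x (S.Rtilde c x (S.ι x (X x)) (S.ι x (Y x)) (S.ι x (Z x))) (S.ι x (W x))
      + S.metric x (S.h X W x) (S.h Y Z x) - S.metric x (S.h X Z x) (S.h Y W x) =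
    (p₁ * q₂ - q₁ * p₂) * (p₄ * q₃ - q₄ * p₃) *
      (c * (3 * S.sinhAngle (e₁ x) (e₂ x) ^ 2 - 1)
        + S.metric x (S.h e₁ e₁ x) (S.h e₂ e₂ x)) := by
  rw [he.h_eq_combination hmin hx hW hXx hWx, he.h_eq_combination hmin hx hZ hYx hZx,
    he.h_eq_combination hmin hx hZ hXx hZx, he.h_eq_combination hmin hx hW hYx hWx,
    hXx, hYx, hZx, hWx, (he.isNullPair hx).metric_Rtilde_combination c]
  simp only [map_add, map_smul, add_apply, smul_apply, smul_eq_mul,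
    S.metric_symm x (S.h e₂ e₂ x) (S.h e₁ e₁ x)]
  ring

variable [T2Space M]

theorem gaussAt_iff (c : ℝ) (hx : x ∈ U) :
    S.GaussAt c x ↔ S.cubicCoeff α e₁ x * S.cubicCoeff α e₂ x =
      dirDeriv e₁ α x * dirDeriv e₂ α x + c * (3 * Real.sinh (α x) ^ 2 - 1) := by
  suffices hscalar : S.GaussAt c x ↔ c * (3 * S.sinhAngle (e₁ x) (e₂ x) ^ 2 - 1)
      + S.metric x (S.h e₁ e₁ x) (S.h e₂ e₂ x) = 0 by
    rw [hscalar, he.metric_h_fst_fst_h_snd_snd hmin hx, sinh_wirtingerAngle]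
    constructor <;> intro h <;> linarith
  have hab := he.isNullPair hx
  constructor
  · intro hG
    obtain ⟨A, hA, hAx⟩ := exists_smoothField_apply_eq (e₁ x)
    obtain ⟨B, hB, hBx⟩ := exists_smoothField_apply_eq (e₂ x)
    have hABBA := hG A B B A hA hB hB hA
    rw [he.R_eq_zero hx hA hB hB, map_zero, LinearMap.zero_apply,
      he.gauss_rhs_eq hmin hx hB.diffFieldAt hA.diffFieldAt (p₁ := 1) (q₁ := 0) (p₂ := 0)
        (q₂ := 1) (p₃ := 0) (q₃ := 1) (p₄ := 1) (q₄ := 0) (by simp [hAx]) (by simp [hBx])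
        (by simp [hBx]) (by simp [hAx])] at hABBA
    linarith
  · intro hscalar X Y Z W hX hY hZ hW
    rw [he.R_eq_zero hx hX hY hZ, map_zero, LinearMap.zero_apply,
      he.gauss_rhs_eq hmin hx hZ.diffFieldAt hW.diffFieldAt (hab.eq_combination _)
        (hab.eq_combination _) (hab.eq_combination _) (hab.eq_combination _), hscalar, mul_zero]

theorem normalConn_h_fst_fst {c : ℝ} (hx : x ∈ U) (hC : S.CodazziAt c x) :
    S.normalConn (S.h e₁ e₁) x (e₂ x) = (-(3 * c * Real.sinh (α x))) • S.F x (e₁ x) := by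
  have hU := he.isOpen.mem_nhds hx
  have hpar : ∀ᶠ y in 𝓝 x, ∀ u, S.nabla e₁ y u = 0 :=
    Filter.eventually_of_mem hU he.parallel_fst
  have hzero : S.normalConn (S.h e₂ e₁) x (e₁ x) = 0 := by
    rw [normalConn, S.conn_eq_zero_of_eventually
      (Filter.eventually_of_mem hU fun y hy ↦ he.h_snd_fst hmin hy), zero_apply, nor_zero]
  have hcodazzi := hC.nor_Rtilde_of_smoothFieldOn hU he.contMDiffOn_snd he.contMDiffOn_fst
    he.contMDiffOn_fst
  rw [(he.isNullPair hx).nor_Rtilde_snd_fst_fst, S.nablaBarH_of_parallel (he.parallel_fst x hx)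
    hpar, S.nablaBarH_of_parallel (he.parallel_snd x hx) hpar, hzero, sub_zero] at hcodazzi
  rw [← hcodazzi, sinh_wirtingerAngle]

theorem metric_conn_h_fst_fst_J_snd {c : ℝ} (hx : x ∈ U) (hC : S.CodazziAt c x) :
    S.metric x (S.conn (S.h e₁ e₁) x (e₂ x)) (S.J x (S.ι x (e₂ x))) =
      3 * c * Real.sinh (α x) * Real.cosh (α x) ^ 2
        + Real.sinh (α x) * S.metric x (S.h e₁ e₁ x) (S.h e₂ e₂ x) := by
  have hnor : S.metric x (S.conn (S.h e₁ e₁) x (e₂ x)) (S.F x (e₂ x)) =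
      3 * c * Real.sinh (α x) * Real.cosh (α x) ^ 2 := by
    rw [← S.metric_nor_left_of_normal (S.metric_F_ι (e₂ x)), ← normalConn,
      he.normalConn_h_fst_fst hmin hx hC, map_smul, smul_apply,
      (he.isNullPair hx).metric_F_fst_snd, one_add_sinhAngle_sq, smul_eq_mul]
    ring
  have htang : S.metric x (S.conn (S.h e₁ e₁) x (e₂ x)) (S.ι x (e₂ x)) =
      -S.metric x (S.h e₂ e₂ x) (S.h e₁ e₁ x) :=
    S.metric_conn_eq_neg_metric_h (fun y u ↦ S.metric_h_ι u)
      (S.diffSecAt_h_of_smoothFieldOn (he.isOpen.mem_nhds hx) he.contMDiffOn_fst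
        he.contMDiffOn_fst) (he.diffFieldAt_snd hx)
  rw [J_ι, he.P_snd hx, map_add, hnor, map_neg, map_neg, map_smul, map_smul, htang,
    S.metric_symm x (S.h e₂ e₂ x), smul_eq_mul]
  ring

theorem mdifferentiableAt_dirDeriv_fst (hx : x ∈ U) :
    MDifferentiableAt (𝓡 2) 𝓘(ℝ, ℝ) (dirDeriv e₁ α) x := by
  have hU := he.isOpen.mem_nhds hx
  have dα := he.mdifferentiableAt_wirtingerAngle hx
  have dinv : MDifferentiableAt (𝓡 2) 𝓘(ℝ, ℝ) (fun y ↦ (Real.cosh (α y))⁻¹) x :=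
    ((Real.differentiable_cosh _).inv (Real.cosh_pos _).ne').mdifferentiableAt.comp x dα
  have dmetric := S.mdifferentiableAt_metric
    (S.diffSecAt_h_of_smoothFieldOn hU he.contMDiffOn_fst he.contMDiffOn_fst)
    (S.diffSecAt_J (S.diffSecAt_ι (he.diffFieldAt_snd hx)))
  refine (dinv.mul dmetric).congr_of_eventuallyEq (Filter.eventually_of_mem hU fun y hy ↦ ?_)
  rw [Pi.mul_apply, ← he.cosh_mul_dirDeriv_fst hmin hy,
    inv_mul_cancel_left₀ (Real.cosh_pos _).ne']

theorem dirDeriv_snd_dirDeriv_fst {c : ℝ} (hx : x ∈ U) (hC : S.CodazziAt c x) :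
    dirDeriv e₂ (dirDeriv e₁ α) x =
      dirDeriv e₁ α x * dirDeriv e₂ α x * Real.tanh (α x)
        + 3 * c * Real.sinh (α x) * Real.cosh (α x) := by
  have hU := he.isOpen.mem_nhds hx
  have dα := he.mdifferentiableAt_wirtingerAngle hx
  have dcosh : MDifferentiableAt (𝓡 2) 𝓘(ℝ, ℝ) (fun y ↦ Real.cosh (α y)) x :=
    (Real.differentiable_cosh _).mdifferentiableAt.comp x dα
  have d₂ := S.diffSecAt_ι (he.diffFieldAt_snd hx)
  -- Differentiate `cosh α · α_x = ⟨h(e₁, e₁), Je₂⟩` along `e₂`.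
  have hderiv : Real.cosh (α x) * dirDeriv e₂ (dirDeriv e₁ α) x
        + dirDeriv e₁ α x * (Real.sinh (α x) * dirDeriv e₂ α x) =
      S.metric x (S.conn (S.h e₁ e₁) x (e₂ x)) (S.J x (S.ι x (e₂ x)))
        + S.metric x (S.h e₁ e₁ x) (S.J x (S.h e₂ e₂ x)) := by
    rw [← dirDeriv_comp (Real.hasDerivAt_cosh _) dα,
      ← dirDeriv_mul dcosh (he.mdifferentiableAt_dirDeriv_fst hmin hx),
      dirDeriv_congr (Filter.eventually_of_mem hU fun y hy ↦ he.cosh_mul_dirDeriv_fst hmin hy),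
      S.dirDeriv_metric (S.diffSecAt_h_of_smoothFieldOn hU he.contMDiffOn_fst he.contMDiffOn_fst)
        (S.diffSecAt_J d₂), S.conn_J x _ d₂, he.conn_snd hx]
  rw [he.metric_conn_h_fst_fst_J_snd hmin hx hC, he.metric_h_fst_fst_h_snd_snd hmin hx,
    he.metric_h_fst_fst_J_h_snd_snd hmin hx] at hderiv
  rw [Real.tanh_eq_sinh_div_cosh]
  have hcosh := (Real.cosh_pos (α x)).ne'
  field_simp
  linarith

end Minimal

end IsParallelNullFrame

end LorentzianSurface

theorem theorem4p1_general
    {M : Type*} [TopologicalSpace M] [T2Space M] [ChartedSpace (EuclideanSpace ℝ (Fin 2)) M]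
    [IsManifold (𝓡 2) ∞ M]
    {E : M → Type*} [TopologicalSpace (TotalSpace R4 E)] [∀ x, AddCommGroup (E x)]
    [∀ x, Module ℝ (E x)] [∀ x, TopologicalSpace (E x)] [∀ x, IsTopologicalAddGroup (E x)]
    [∀ x, ContinuousSMul ℝ (E x)] [FiberBundle R4 E] [VectorBundle ℝ R4 E]
    [ContMDiffVectorBundle ∞ R4 E (𝓡 2)]
    (S : LorentzianSurface M E) (c : ℝ) :
    (∀ x, S.GaussAt c x → S.CodazziAt c x → S.RicciAt c x) ∧
    ∀ (U : Set M) (e₁ e₂ : ∀ x : M, TangentSpace (𝓡 2) x), S.IsParallelNullFrame U e₁ e₂ →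
      ∀ α : M → ℝ, α = S.wirtingerAngle e₁ e₂ →
      ContMDiffOn (𝓡 2) 𝓘(ℝ, ℝ) ∞ α U ∧
      (∀ x ∈ U, S.P x (e₁ x) = Real.sinh (α x) • e₁ x ∧
        S.P x (e₂ x) = -(Real.sinh (α x) • e₂ x)) ∧
      ((∀ x ∈ U, S.meanCurvature x = 0) → ∃ β γ lam μ : M → ℝ,
        (∀ x ∈ U,
          S.h e₁ e₁ x = β x • S.adaptedNormal α e₁ x + γ x • S.adaptedNormal α e₂ x ∧
          S.h e₁ e₂ x = 0 ∧
          S.h e₂ e₂ x = lam x • S.adaptedNormal α e₁ x + μ x • S.adaptedNormal α e₂ x) ∧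
        (∀ x ∈ U, S.CodazziAt c x →
          dirDeriv e₂ (dirDeriv e₁ α) x =
            dirDeriv e₁ α x * dirDeriv e₂ α x * Real.tanh (α x)
              + 3 * c * Real.sinh (α x) * Real.cosh (α x)) ∧
        (∀ x ∈ U, S.GaussAt c x ↔
          γ x * lam x = dirDeriv e₁ α x * dirDeriv e₂ α x
            + c * (3 * Real.sinh (α x) ^ 2 - 1))) := by
  refine ⟨fun x hG hC ↦ S.ricciAt_of_gaussAt_of_codazziAt hG hC, ?_⟩
  rintro U e₁ e₂ he _ rfl
  set α := S.wirtingerAngle e₁ e₂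
  refine ⟨he.contMDiffOn_wirtingerAngle, fun x hx ↦ ⟨he.P_fst hx, he.P_snd hx⟩, fun hmin ↦ ?_⟩
  exact ⟨fun x ↦ -dirDeriv e₁ α x, S.cubicCoeff α e₁, S.cubicCoeff α e₂, dirDeriv e₂ α,
    fun x hx ↦ ⟨he.h_fst_fst hmin hx, he.h_fst_snd hmin hx, he.h_snd_snd hmin hx⟩,
    fun x hx hC ↦ he.dirDeriv_snd_dirDeriv_fst hmin hx hC,
    fun x hx ↦ he.gaussAt_iff hmin c hx⟩

theorem theorem4p1
    {M : Type*} [TopologicalSpace M] [T2Space M] [ChartedSpace (EuclideanSpace ℝ (Fin 2)) M]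
    [IsManifold (𝓡 2) ∞ M]
    {E : M → Type*} [TopologicalSpace (TotalSpace R4 E)] [∀ x, AddCommGroup (E x)]
    [∀ x, Module ℝ (E x)] [∀ x, TopologicalSpace (E x)] [∀ x, IsTopologicalAddGroup (E x)]
    [∀ x, ContinuousSMul ℝ (E x)] [FiberBundle R4 E] [VectorBundle ℝ R4 E]
    [ContMDiffVectorBundle ∞ R4 E (𝓡 2)]
    (S : LorentzianSurface M E) (c : ℝ) (hmin : S.IsMinimal) (hflat : S.IsFlat) :
    (∀ x, S.GaussAt c x → S.CodazziAt c x → S.RicciAt c x) ∧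
    ∀ (U : Set M) (e₁ e₂ : ∀ x : M, TangentSpace (𝓡 2) x), S.IsParallelNullFrame U e₁ e₂ →
      ∀ α : M → ℝ, α = S.wirtingerAngle e₁ e₂ →
      ContMDiffOn (𝓡 2) 𝓘(ℝ, ℝ) ∞ α U ∧
      (∀ x ∈ U, S.P x (e₁ x) = Real.sinh (α x) • e₁ x ∧
        S.P x (e₂ x) = -(Real.sinh (α x) • e₂ x)) ∧
      ∃ β γ lam μ : M → ℝ,
        (∀ x ∈ U,
          S.h e₁ e₁ x = β x • S.adaptedNormal α e₁ x + γ x • S.adaptedNormal α e₂ x ∧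
          S.h e₁ e₂ x = 0 ∧
          S.h e₂ e₂ x = lam x • S.adaptedNormal α e₁ x + μ x • S.adaptedNormal α e₂ x) ∧
        (∀ x ∈ U, S.CodazziAt c x →
          dirDeriv e₂ (dirDeriv e₁ α) x =
            dirDeriv e₁ α x * dirDeriv e₂ α x * Real.tanh (α x)
              + 3 * c * Real.sinh (α x) * Real.cosh (α x)) ∧
        (∀ x ∈ U, S.GaussAt c x ↔
          γ x * lam x = dirDeriv e₁ α x * dirDeriv e₂ α x
            + c * (3 * Real.sinh (α x) ^ 2 - 1)) := by
  obtain ⟨ricci, frame⟩ := theorem4p1_general S c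
  refine ⟨ricci, fun U e₁ e₂ he α hα ↦ ?_⟩
  obtain ⟨hsmooth, hP, hminimal⟩ := frame U e₁ e₂ he α hα
  exact ⟨hsmooth, hP, hminimal fun x _ ↦ hmin x⟩
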